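/- Let $\mathcal C$ be a spherical fusion category over $\mathbb C$: a $\mathbb C$-linear, semisimple monoidal category (associator $a$, not assumed strict) with finitely many isomorphism classes of simple objects, finite-dimensional Hom-spaces and $\mathrm{End}(\mathbf 1)=\mathbb C$, in which distinct simple objects have no nonzero morphisms between them, and which has a pivotal structure (each object $X$ has an object $X^*$ that is both its right and its left dual, and the right and left duality agree as monoidal functors; this includes strict pivotal structures on strict categories) whose left and right traces agree. Assume every simple object is self-dual, $x\cong x^*$. Fix representatives of the isomorphism classes of simple objects; all labels $u,v,w,x,y,z$ below range over these. Fix a square root $\sqrt{x}$ of the quantum dimension of each such $x$ (and write $\sqrt{uv}=\sqrt u\sqrt v$). For all $u,v,x$ fix a basis of $\mathrm{Hom}(u\otimes v,x)$ and, for each basis vector $\alpha$, a vector $\bar\alpha\in\mathrm{Hom}(x,u\otimes v)$ such that, for all basis vectors $\alpha,\beta$ of $\mathrm{Hom}(u\otimes v,x)$, $$\beta\circ\bar\alpha=\delta_{\alpha,\beta}\,\frac{\sqrt{uv}}{\sqrt{x}}\,\mathrm{id}_x .\qquad(\theta_1)$$ Then the morphisms used as expansion vectors on the right-hand sides below are bases,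 and the following matrices (column $y\alpha\beta$, row $z\gamma\delta$) are defined. * $F^x_{uvw}$: $\ \beta\circ(\mathrm{id}_u\otimes\alpha)\circ a_{u,v,w}=\sum_{z,\gamma,\delta}(F^x_{uvw})^{y\alpha\beta}_{z\gamma\delta}\;\delta\circ(\gamma\otimes \mathrm{id}_w)$, with basis vectors $\alpha:v\otimes w\to y$, $\beta:u\otimes y\to x$, $\gamma:u\otimes v\to z$, $\delta:z\otimes w\to x$. * $G^{uvw}_x$: $\ a_{u,v,w}^{-1}\circ(\mathrm{id}_u\otimes\bar\alpha)\circ\bar\beta=\sum_{z,\gamma,\delta}(G^{uvw}_x)^{y\beta\alpha}_{z\delta\gamma}\;(\bar\gamma\otimes \mathrm{id}_w)\circ\bar\delta$, with $\alpha,\beta,\gamma,\delta$ as for $F$. * $(+)6j$-symbols: $\ (\mathrm{id}_u\otimes\beta)\circ a_{u,y,x}\circ(\bar\alpha\otimes\mathrm{id}_x)=\sum_{z,\gamma,\delta}\left\{\begin{smallmatrix}u&v&y(\alpha\beta)\\w&x&z(\gamma\delta)\end{smallmatrix}\right\}_{+}\bar\delta\circ\gamma$, with $\alpha:u\otimes y\to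 w$, $\beta:y\otimes x\to v$, $\gamma:w\otimes x\to z$, $\delta:u\otimes v\to z$. * $(-)6j$-symbols: $\ (\beta\otimes\mathrm{id}_v)\circ a_{w,y,v}^{-1}\circ(\mathrm{id}_w\otimes\bar\alpha)=\sum_{z,\gamma,\delta}\left\{\begin{smallmatrix}u&v&y(\alpha\beta)\\w&x&z(\gamma\delta)\end{smallmatrix}\right\}_{-}\bar\delta\circ\gamma$, with $\alpha:y\otimes v\to x$, $\beta:w\otimes y\to u$, $\gamma:w\otimes x\to z$, $\delta:u\otimes v\to z$. Assume that all matrices $F^x_{uvw}$ are unitary ($M^\dagger M=1$ and $MM^\dagger=1$). Then: 1. (Mirror conjugate symmetry) For all labels and basis vectors, $$(G^{uvw}_{x})^{y\beta\alpha}_{z\delta\gamma}=\overline{(F^{x}_{uvw})^{y\alpha\beta}_{z\gamma\delta}},\qquad \left\{\begin{smallmatrix}w&x&y(\beta\alpha)\\u&v&z(\delta\gamma)\end{smallmatrix}\right\}_{-}=\overline{\left\{\begin{smallmatrix}u&v&y(\alpha\beta)\\w&x&z(\gamma\delta)\end{smallmatrix}\right\}_{+}} .$$ 2. For all $u,v,w,x$,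 the matrices $\left\{\begin{smallmatrix}u&v&-\\w&x&-\end{smallmatrix}\right\}_{+}$ and $\left\{\begin{smallmatrix}u&v&-\\w&x&-\end{smallmatrix}\right\}_{-}$ are unitary. -/

import Mathlib

open CategoryTheory MonoidalCategory

set_option linter.unusedSectionVars false

noncomputable section

namespace SphericalFusion

universe v u

section Pivotal

/-- A pivotal structure on a monoidal category: every object `X` has an object `dual X` which is
simultaneously a right dual and a left dual of `X`, and the right and the left duality agree as
monoidal functors (on morphisms, and in their comparison isomorphisms for the unit and for tensor
products). In Mathlib's convention `ExactPairing X Y` consists of `𝟙_ ⟶ X ⊗ Y` and `Y ⊗ X ⟶ 𝟙_`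
satisfying the two zigzag identities. -/
class PivotalCategory (C : Type u) [Category.{v} C] [MonoidalCategory C] where
  /-- The two-sided dual of an object. -/
  dual : C → C
  /-- `b_X : 𝟙_ ⟶ X ⊗ dual X` and `d_X : dual X ⊗ X ⟶ 𝟙_`. -/
  rightPairing : ∀ X : C, ExactPairing X (dual X)
  /-- `𝟙_ ⟶ dual X ⊗ X` and `X ⊗ dual X ⟶ 𝟙_`. -/
  leftPairing : ∀ X : C, ExactPairing (dual X) X
  /-- The right dual and the left dual of every morphism coincide. -/
  mate_eq : ∀ {X Y : C} (f : X ⟶ Y),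
    (@rightAdjointMate C _ _ X Y
      (@HasRightDual.mk C _ _ X (dual X) (rightPairing X))
      (@HasRightDual.mk C _ _ Y (dual Y) (rightPairing Y)) f : dual Y ⟶ dual X) =
    @leftAdjointMate C _ _ X Y
      (@HasLeftDual.mk C _ _ X (dual X) (leftPairing X))
      (@HasLeftDual.mk C _ _ Y (dual Y) (leftPairing Y)) f
  /-- The canonical maps `dual 𝟙_ ⟶ 𝟙_` for the two dualities coincide. -/
  unit_eq :
    (rightDualIso (rightPairing (𝟙_ C)) exactPairingUnit).hom =
      (leftDualIso (leftPairing (𝟙_ C)) exactPairingUnit).hom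
  /-- The canonical maps `dual (X ⊗ Y) ⟶ dual Y ⊗ dual X` for the two dualities coincide. -/
  tensor_eq : ∀ X Y : C,
    (rightDualIso (rightPairing (X ⊗ Y))
      (@ExactPairing.tensor C _ _ X Y (dual X) (dual Y) (rightPairing X) (rightPairing Y))).hom =
    (leftDualIso (leftPairing (X ⊗ Y))
      (@ExactPairing.tensor C _ _ (dual Y) (dual X) Y X (leftPairing Y) (leftPairing X))).hom

variable {C : Type u} [Category.{v} C] [MonoidalCategory C] [PivotalCategory C]

/-- The coevaluation `b_X : 𝟙_ ⟶ X ⊗ dual X` of the right duality. -/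
def coevR (X : C) : 𝟙_ C ⟶ X ⊗ PivotalCategory.dual X :=
  @ExactPairing.coevaluation C _ _ X (PivotalCategory.dual X) (PivotalCategory.rightPairing X)

/-- The evaluation `d_X : dual X ⊗ X ⟶ 𝟙_` of the right duality. -/
def evR (X : C) : PivotalCategory.dual X ⊗ X ⟶ 𝟙_ C :=
  @ExactPairing.evaluation C _ _ X (PivotalCategory.dual X) (PivotalCategory.rightPairing X)

/-- The coevaluation `𝟙_ ⟶ dual X ⊗ X` of the left duality. -/
def coevL (X : C) : 𝟙_ C ⟶ PivotalCategory.dual X ⊗ X :=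
  @ExactPairing.coevaluation C _ _ (PivotalCategory.dual X) X (PivotalCategory.leftPairing X)

/-- The evaluation `X ⊗ dual X ⟶ 𝟙_` of the left duality. -/
def evL (X : C) : X ⊗ PivotalCategory.dual X ⟶ 𝟙_ C :=
  @ExactPairing.evaluation C _ _ (PivotalCategory.dual X) X (PivotalCategory.leftPairing X)

/-- The right trace of an endomorphism. -/
def trRight {X : C} (f : X ⟶ X) : 𝟙_ C ⟶ 𝟙_ C :=
  coevR X ≫ f ▷ PivotalCategory.dual X ≫ evL X

/-- The left trace of an endomorphism. -/
def trLeft {X : C} (f : X ⟶ X) : 𝟙_ C ⟶ 𝟙_ C :=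
  coevL X ≫ PivotalCategory.dual X ◁ f ≫ evR X

variable (C) in
/-- A pivotal category is spherical if left and right traces agree. -/
class IsSpherical : Prop where
  tr_eq : ∀ {X : C} (f : X ⟶ X), trRight f = trLeft f

end Pivotal

section Fusion

variable (C : Type u) [Category.{v} C] [Preadditive C] [Linear ℂ C]

variable {C} in
/-- An object is simple if `c ↦ c • 𝟙 X` is an isomorphism from `ℂ` to `End X`. -/
def IsSimpleObject (X : C) : Prop :=
  Function.Bijective (fun c : ℂ => c • 𝟙 X)

/-- A fusion category over `ℂ` (the duals are part of the pivotal structure). -/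
class IsFusion [MonoidalCategory C] : Prop where
  finiteDimensional : ∀ X Y : C, FiniteDimensional ℂ (X ⟶ Y)
  unit_simple : IsSimpleObject (𝟙_ C)
  /-- Every object is a direct sum of finitely many simple objects. -/
  semisimple : ∀ X : C, ∃ (n : ℕ) (s : Fin n → C) (b : Limits.Bicone s),
    (∀ i, IsSimpleObject (s i)) ∧ Nonempty b.IsBilimit ∧ Nonempty (X ≅ b.pt)
  /-- Non-isomorphic simple objects have no nonzero morphisms between them. -/
  hom_eq_zero : ∀ X Y : C, IsSimpleObject X → IsSimpleObject Y → IsEmpty (X ≅ Y) →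
    ∀ f : X ⟶ Y, f = 0
  /-- There are finitely many isomorphism classes of simple objects. -/
  finite_simples : ∃ (n : ℕ) (s : Fin n → C),
    ∀ X : C, IsSimpleObject X → ∃ i, Nonempty (X ≅ s i)

/-- A family of representatives of the isomorphism classes of simple objects, indexed by `I`. -/
structure SimpleReps (I : Type*) where
  obj : I → C
  simple : ∀ i, IsSimpleObject (obj i)
  not_iso : ∀ i j, i ≠ j → IsEmpty (obj i ≅ obj j)
  complete : ∀ X : C, IsSimpleObject X → ∃ i, Nonempty (X ≅ obj i)

end Fusion

variable {C : Type u} [Category.{v} C] [Preadditive C] [Linear ℂ C] [MonoidalCategory C]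

section QuantumDim

variable [PivotalCategory C] [IsFusion C]

/-- The quantum dimension: the trace of `𝟙 X`, as a complex number via `End 𝟙_ ≅ ℂ`. -/
def qdim (X : C) : ℂ :=
  (Equiv.ofBijective (fun c : ℂ => c • 𝟙 (𝟙_ C)) IsFusion.unit_simple).symm (trRight (𝟙 X))

theorem qdim_smul (X : C) : qdim X • 𝟙 (𝟙_ C) = trRight (𝟙 X) :=
  Equiv.apply_symm_apply (Equiv.ofBijective (fun c : ℂ => c • 𝟙 (𝟙_ C)) IsFusion.unit_simple) _

end QuantumDim

section Decomposition

variable [IsFusion C]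

theorem id_mem_span (X : C) :
    𝟙 X ∈ Submodule.span ℂ {f : X ⟶ X | ∃ (s : C) (a : X ⟶ s) (b : s ⟶ X),
      IsSimpleObject s ∧ f = a ≫ b} := by
  obtain ⟨n, s, b, hs, ⟨hb⟩, ⟨e⟩⟩ := IsFusion.semisimple X
  have h : 𝟙 X = ∑ k, (e.hom ≫ b.π k) ≫ (b.ι k ≫ e.inv) := by
    have h1 := Limits.IsBilimit.total hb
    calc 𝟙 X = e.hom ≫ 𝟙 b.pt ≫ e.inv := by simp
      _ = _ := by
        rw [← h1, Preadditive.sum_comp, Preadditive.comp_sum]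
        simp
  rw [h]
  exact Submodule.sum_mem _ fun k _ => Submodule.subset_span ⟨s k, _, _, hs k, rfl⟩

theorem IsSimpleObject.exists_smul {X : C} (hX : IsSimpleObject X) (f : X ⟶ X) :
    ∃ c : ℂ, f = c • 𝟙 X := by
  obtain ⟨c, hc⟩ := hX.2 f
  exact ⟨c, hc.symm⟩

theorem IsSimpleObject.id_ne_zero {X : C} (hX : IsSimpleObject X) : 𝟙 X ≠ 0 := by
  intro h
  have := @hX.1 0 1 (by simp [h])
  exact zero_ne_one this

variable [MonoidalPreadditive C] [MonoidalLinear ℂ C] [PivotalCategory C]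

/-- Simple objects have nonzero quantum dimension. -/
theorem qdim_ne_zero {X : C} (hX : IsSimpleObject X) : qdim X ≠ 0 := by
  intro h0
  have htr : coevR X ≫ evL X = 0 := by
    have h1 := qdim_smul X
    rw [h0, zero_smul] at h1
    simpa [trRight] using h1.symm
  have hev : ∀ g : X ⊗ PivotalCategory.dual X ⟶ 𝟙_ C, ∃ c : ℂ, g = c • evL X := by
    intro g
    let _ := PivotalCategory.leftPairing X
    let E := tensorRightHomEquiv X (PivotalCategory.dual X) X (𝟙_ C)
    obtain ⟨c, hc⟩ := hX.exists_smul (E g ≫ (λ_ X).hom)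
    have h2 : E g = c • (λ_ X).inv := by
      rw [← cancel_mono (λ_ X).hom, hc]; simp
    refine ⟨c, ?_⟩
    rw [← E.symm_apply_apply g, h2]
    simp only [E, tensorRightHomEquiv, Equiv.coe_fn_symm_mk]
    simp only [MonoidalLinear.smul_whiskerRight, Linear.smul_comp]
    congr 1
    change _ = ε_ (PivotalCategory.dual X) X
    simp only [leftUnitor_inv_whiskerRight, Category.assoc, Iso.inv_hom_id_assoc,
      id_whiskerLeft, ← unitors_equal, Iso.inv_hom_id, Category.comp_id]
  have hzero : ∀ f ∈ Submodule.span ℂ {f : X ⊗ PivotalCategory.dual X ⟶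
      X ⊗ PivotalCategory.dual X | ∃ (s : C) (a : _ ⟶ s) (b : s ⟶ _),
      IsSimpleObject s ∧ f = a ≫ b}, coevR X ≫ f = 0 := by
    intro f hf
    induction hf using Submodule.span_induction with
    | mem f hf =>
      obtain ⟨s, a, b, hs, rfl⟩ := hf
      have : coevR X ≫ a = 0 := by
        by_cases hi : IsEmpty (𝟙_ C ≅ s)
        · exact IsFusion.hom_eq_zero _ _ IsFusion.unit_simple hs hi _
        · obtain ⟨e⟩ := not_isEmpty_iff.mp hi
          obtain ⟨c, hc⟩ := hev (a ≫ e.inv)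
          rw [← cancel_mono e.inv, Category.assoc, hc]
          simp [htr]
      rw [← Category.assoc, this, Limits.zero_comp]
    | zero => simp
    | add f g _ _ hf hg => simp [hf, hg]
    | smul c f _ hf => simp [hf]
  have hcoev : coevR X = 0 := by
    simpa using hzero _ (id_mem_span _)
  apply hX.id_ne_zero
  let _ := PivotalCategory.rightPairing X
  have hz := ExactPairing.evaluation_coevaluation X (PivotalCategory.dual X)
  have hz' : η_ X (PivotalCategory.dual X) = 0 := hcoev
  rw [hz'] at hz
  have h3 : (λ_ X).hom ≫ (ρ_ X).inv = 0 := by rw [← hz]; simp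
  calc 𝟙 X = (λ_ X).inv ≫ ((λ_ X).hom ≫ (ρ_ X).inv) ≫ (ρ_ X).hom := by simp
    _ = 0 := by rw [h3]; simp

end Decomposition

section Trivalent

variable {I : Type*} (S : SimpleReps C I)

/-- The fusion multiplicity `dim Hom(u ⊗ v, x)`. -/
abbrev mult (u v x : I) : ℕ := Module.finrank ℂ (S.obj u ⊗ S.obj v ⟶ S.obj x)

variable [MonoidalPreadditive C] [MonoidalLinear ℂ C] [PivotalCategory C] [IsFusion C]

/-- A choice of square roots of the quantum dimensions of the simple objects, of a basis of each
`Hom(u ⊗ v, x)`, and of algebraic dual basis vectors in `Hom(x, u ⊗ v)` normalized by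
`β ∘ bar α = δ_{α,β} (√u √v / √x) id_x`. -/
structure TrivalentBasis where
  /-- The chosen square root of the quantum dimension. -/
  sqrtDim : I → ℂ
  sqrtDim_sq : ∀ i, sqrtDim i ^ 2 = qdim (S.obj i)
  vec : ∀ u v x : I, Module.Basis (Fin (mult S u v x)) ℂ (S.obj u ⊗ S.obj v ⟶ S.obj x)
  bar : ∀ u v x : I, Fin (mult S u v x) → (S.obj x ⟶ S.obj u ⊗ S.obj v)
  theta1 : ∀ (u v x : I) (α β : Fin (mult S u v x)),
    bar u v x α ≫ vec u v x β =
      if α = β then (sqrtDim u * sqrtDim v / sqrtDim x) • 𝟙 (S.obj x) else 0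

variable {S}

namespace TrivalentBasis

variable (T : TrivalentBasis S)

theorem sqrtDim_ne_zero (i : I) : T.sqrtDim i ≠ 0 := by
  intro h
  have := T.sqrtDim_sq i
  rw [h] at this
  exact qdim_ne_zero (S.simple i) (by simpa using this.symm)

/-- The normalization constant `√u √v / √x`. -/
def normConst (u v x : I) : ℂ := T.sqrtDim u * T.sqrtDim v / T.sqrtDim x

theorem normConst_ne_zero (u v x : I) : T.normConst u v x ≠ 0 :=
  div_ne_zero (mul_ne_zero (T.sqrtDim_ne_zero u) (T.sqrtDim_ne_zero v)) (T.sqrtDim_ne_zero x)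

theorem bar_vec_ne (u v : I) {x x' : I} (h : x ≠ x') (α : Fin (mult S u v x))
    (f : S.obj u ⊗ S.obj v ⟶ S.obj x') : T.bar u v x α ≫ f = 0 :=
  IsFusion.hom_eq_zero _ _ (S.simple x) (S.simple x') (S.not_iso x x' h) _

variable [Fintype I]

theorem completeness (u v : I) :
    ∑ p : (x : I) × Fin (mult S u v x),
      (T.normConst u v p.1)⁻¹ • (T.vec u v p.1 p.2 ≫ T.bar u v p.1 p.2) =
    𝟙 (S.obj u ⊗ S.obj v) := by
  classical
  set E := ∑ p : (x : I) × Fin (mult S u v x),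
      (T.normConst u v p.1)⁻¹ • (T.vec u v p.1 p.2 ≫ T.bar u v p.1 p.2) with hE
  have hvec : ∀ (x : I) (α : Fin (mult S u v x)), E ≫ T.vec u v x α = T.vec u v x α := by
    intro x α
    rw [hE, Preadditive.sum_comp, Finset.sum_eq_single ⟨x, α⟩]
    · rw [Linear.smul_comp, Category.assoc, T.theta1, if_pos rfl, Linear.comp_smul, smul_smul]
      change ((T.normConst u v x)⁻¹ * T.normConst u v x) • _ = _
      rw [inv_mul_cancel₀ (T.normConst_ne_zero u v x)]
      simp
    · rintro ⟨x', α'⟩ - hne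
      rw [Linear.smul_comp, Category.assoc]
      by_cases hx : x' = x
      · subst hx
        rw [T.theta1, if_neg (by rintro rfl; exact hne rfl)]
        simp
      · rw [T.bar_vec_ne u v hx]
        simp
    · simp
  have hall : ∀ (x : I) (a : S.obj u ⊗ S.obj v ⟶ S.obj x), E ≫ a = a := by
    intro x a
    rw [← (T.vec u v x).sum_repr a, Preadditive.comp_sum]
    simp only [Linear.comp_smul, hvec]
  have hspan : ∀ f ∈ Submodule.span ℂ {f : S.obj u ⊗ S.obj v ⟶ S.obj u ⊗ S.obj v |
      ∃ (s : C) (a : _ ⟶ s) (b : s ⟶ _), IsSimpleObject s ∧ f = a ≫ b}, E ≫ f = f := by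
    intro f hf
    induction hf using Submodule.span_induction with
    | mem f hf =>
      obtain ⟨s, a, b, hs, rfl⟩ := hf
      obtain ⟨x, ⟨e⟩⟩ := S.complete s hs
      have := hall x (a ≫ e.hom)
      rw [← Category.assoc, cancel_mono] at this
      rw [← Category.assoc, this]
    | zero => simp
    | add f g _ _ hf hg => simp [hf, hg]
    | smul c f _ hf => simp [hf]
  simpa using hspan _ (id_mem_span _)

theorem smul_bar_mem (u v x : I) (g : S.obj x ⟶ S.obj u ⊗ S.obj v) :
    g ∈ Submodule.span ℂ (Set.range (T.bar u v x)) := by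
  rw [← Category.comp_id g, ← T.completeness u v, Preadditive.comp_sum]
  refine Submodule.sum_mem _ ?_
  rintro ⟨x', α⟩ -
  rw [Linear.comp_smul, ← Category.assoc]
  refine Submodule.smul_mem _ _ ?_
  by_cases hx : x = x'
  · subst hx
    obtain ⟨c, hc⟩ := (S.simple x).exists_smul (g ≫ T.vec u v x α)
    dsimp only
    rw [hc, Linear.smul_comp, Category.id_comp]
    exact Submodule.smul_mem _ _ (Submodule.subset_span ⟨α, rfl⟩)
  · have : g ≫ T.vec u v x' α = 0 :=
      IsFusion.hom_eq_zero _ _ (S.simple x) (S.simple x') (S.not_iso x x' hx) _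
    dsimp only
    rw [this]
    simp

theorem bar_linearIndependent (u v x : I) : LinearIndependent ℂ (T.bar u v x) := by
  rw [Fintype.linearIndependent_iff]
  intro g hg α
  have h := congrArg (· ≫ T.vec u v x α) hg
  simp only [Preadditive.sum_comp, Linear.smul_comp, T.theta1, Limits.zero_comp, smul_ite,
    smul_zero, Finset.sum_ite_eq', Finset.mem_univ, if_true, smul_smul] at h
  rcases smul_eq_zero.mp h with h | h
  · exact (mul_eq_zero.mp h).resolve_right (T.normConst_ne_zero u v x)
  · exact absurd h (S.simple x).id_ne_zero

/-- The algebraic dual basis vectors form a basis of `Hom(x, u ⊗ v)`. -/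
def barBasis (u v x : I) : Module.Basis (Fin (mult S u v x)) ℂ (S.obj x ⟶ S.obj u ⊗ S.obj v) :=
  Module.Basis.mk (T.bar_linearIndependent u v x) fun g _ => T.smul_bar_mem u v x g

theorem barBasis_apply (u v x : I) (α : Fin (mult S u v x)) :
    T.barBasis u v x α = T.bar u v x α := by
  simp [barBasis]

/-- The vector `δ ∘ (γ ⊗ id_w)`, for `γ : u ⊗ v ⟶ z` and `δ : z ⊗ w ⟶ x`. -/
def leftTree (u v w x : I) (p : (z : I) × (Fin (mult S u v z) × Fin (mult S z w x))) :
    (S.obj u ⊗ S.obj v) ⊗ S.obj w ⟶ S.obj x :=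
  T.vec u v p.1 p.2.1 ▷ S.obj w ≫ T.vec p.1 w x p.2.2

/-- The vector `β ∘ (id_u ⊗ α)`, for `α : v ⊗ w ⟶ y` and `β : u ⊗ y ⟶ x`. -/
def rightTree (u v w x : I) (q : (y : I) × (Fin (mult S v w y) × Fin (mult S u y x))) :
    S.obj u ⊗ (S.obj v ⊗ S.obj w) ⟶ S.obj x :=
  S.obj u ◁ T.vec v w q.1 q.2.1 ≫ T.vec u q.1 x q.2.2

/-- The vector `(bar γ ⊗ id_w) ∘ bar δ`. -/
def leftCotree (u v w x : I) (p : (z : I) × (Fin (mult S u v z) × Fin (mult S z w x))) :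
    S.obj x ⟶ (S.obj u ⊗ S.obj v) ⊗ S.obj w :=
  T.bar p.1 w x p.2.2 ≫ T.bar u v p.1 p.2.1 ▷ S.obj w

/-- The vector `(id_u ⊗ bar α) ∘ bar β`. -/
def rightCotree (u v w x : I) (q : (y : I) × (Fin (mult S v w y) × Fin (mult S u y x))) :
    S.obj x ⟶ S.obj u ⊗ (S.obj v ⊗ S.obj w) :=
  T.bar u q.1 x q.2.2 ≫ S.obj u ◁ T.bar v w q.1 q.2.1

/-- The vector `bar δ ∘ γ : w ⊗ x ⟶ z ⟶ u ⊗ v`. -/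
def channel (u v w x : I) (p : (z : I) × (Fin (mult S w x z) × Fin (mult S u v z))) :
    S.obj w ⊗ S.obj x ⟶ S.obj u ⊗ S.obj v :=
  T.vec w x p.1 p.2.1 ≫ T.bar u v p.1 p.2.2

theorem leftTree_span (u v w x : I) (f : (S.obj u ⊗ S.obj v) ⊗ S.obj w ⟶ S.obj x) :
    f ∈ Submodule.span ℂ (Set.range (T.leftTree u v w x)) := by
  have h : f = (𝟙 (S.obj u ⊗ S.obj v)) ▷ S.obj w ≫ f := by simp
  rw [h, ← T.completeness u v, sum_whiskerRight, Preadditive.sum_comp]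
  refine Submodule.sum_mem _ ?_
  rintro ⟨z, γ⟩ -
  rw [MonoidalLinear.smul_whiskerRight, Linear.smul_comp, comp_whiskerRight, Category.assoc]
  refine Submodule.smul_mem _ _ ?_
  dsimp only
  rw [← (T.vec z w x).sum_repr (T.bar u v z γ ▷ S.obj w ≫ f), Preadditive.comp_sum]
  refine Submodule.sum_mem _ fun δ _ => ?_
  rw [Linear.comp_smul]
  exact Submodule.smul_mem _ _ (Submodule.subset_span ⟨⟨z, γ, δ⟩, rfl⟩)

theorem leftCotree_span (u v w x : I) (f : S.obj x ⟶ (S.obj u ⊗ S.obj v) ⊗ S.obj w) :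
    f ∈ Submodule.span ℂ (Set.range (T.leftCotree u v w x)) := by
  have h : f = f ≫ (𝟙 (S.obj u ⊗ S.obj v)) ▷ S.obj w := by simp
  rw [h, ← T.completeness u v, sum_whiskerRight, Preadditive.comp_sum]
  refine Submodule.sum_mem _ ?_
  rintro ⟨z, γ⟩ -
  rw [MonoidalLinear.smul_whiskerRight, Linear.comp_smul, comp_whiskerRight, ← Category.assoc]
  refine Submodule.smul_mem _ _ ?_
  dsimp only
  rw [← (T.barBasis z w x).sum_repr (f ≫ T.vec u v z γ ▷ S.obj w), Preadditive.sum_comp]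
  refine Submodule.sum_mem _ fun δ _ => ?_
  rw [Linear.smul_comp, barBasis_apply]
  exact Submodule.smul_mem _ _ (Submodule.subset_span ⟨⟨z, γ, δ⟩, rfl⟩)

theorem channel_span (u v w x : I) (f : S.obj w ⊗ S.obj x ⟶ S.obj u ⊗ S.obj v) :
    f ∈ Submodule.span ℂ (Set.range (T.channel u v w x)) := by
  rw [← Category.id_comp f, ← T.completeness w x, Preadditive.sum_comp]
  refine Submodule.sum_mem _ ?_
  rintro ⟨z, γ⟩ -
  rw [Linear.smul_comp, Category.assoc]
  refine Submodule.smul_mem _ _ ?_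
  dsimp only
  rw [← (T.barBasis u v z).sum_repr (T.bar w x z γ ≫ f), Preadditive.comp_sum]
  refine Submodule.sum_mem _ fun δ _ => ?_
  rw [Linear.comp_smul, barBasis_apply]
  exact Submodule.smul_mem _ _ (Submodule.subset_span ⟨⟨z, γ, δ⟩, rfl⟩)

theorem leftTree_linearIndependent (u v w x : I) :
    LinearIndependent ℂ (T.leftTree u v w x) := by
  classical
  rw [Fintype.linearIndependent_iff]
  rintro g hg ⟨z, γ, δ⟩
  have h := congrArg (T.bar u v z γ ▷ S.obj w ≫ ·) hg
  simp only [Preadditive.comp_sum, Limits.comp_zero, Linear.comp_smul, leftTree,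
    Fintype.sum_sigma, Fintype.sum_prod_type] at h
  rw [Finset.sum_eq_single z, Finset.sum_eq_single γ] at h
  · simp only [← comp_whiskerRight_assoc, T.theta1, if_true, MonoidalLinear.smul_whiskerRight,
      id_whiskerRight, Linear.smul_comp, Category.id_comp, smul_smul] at h
    have h2 := Fintype.linearIndependent_iff.mp (T.vec z w x).linearIndependent _ h δ
    exact (mul_eq_zero.mp h2).resolve_right (T.normConst_ne_zero u v z)
  · intro γ' _ hne
    refine Finset.sum_eq_zero fun δ' _ => ?_
    rw [← comp_whiskerRight_assoc, T.theta1, if_neg (Ne.symm hne)]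
    simp
  · simp
  · intro z' _ hne
    refine Finset.sum_eq_zero fun γ' _ => Finset.sum_eq_zero fun δ' _ => ?_
    rw [← comp_whiskerRight_assoc, T.bar_vec_ne u v (Ne.symm hne)]
    simp
  · simp

theorem leftCotree_linearIndependent (u v w x : I) :
    LinearIndependent ℂ (T.leftCotree u v w x) := by
  classical
  rw [Fintype.linearIndependent_iff]
  rintro g hg ⟨z, γ, δ⟩
  have h := congrArg (· ≫ T.vec u v z γ ▷ S.obj w) hg
  simp only [Preadditive.sum_comp, Limits.zero_comp, Linear.smul_comp, leftCotree,
    Fintype.sum_sigma, Fintype.sum_prod_type, Category.assoc, ← comp_whiskerRight] at h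
  rw [Finset.sum_eq_single z, Finset.sum_eq_single γ] at h
  · simp only [T.theta1, if_true, MonoidalLinear.smul_whiskerRight,
      id_whiskerRight, Linear.comp_smul, Category.comp_id, smul_smul] at h
    have h2 := Fintype.linearIndependent_iff.mp (T.bar_linearIndependent z w x) _ h δ
    exact (mul_eq_zero.mp h2).resolve_right (T.normConst_ne_zero u v z)
  · intro γ' _ hne
    refine Finset.sum_eq_zero fun δ' _ => ?_
    rw [T.theta1, if_neg hne]
    simp
  · simp
  · intro z' _ hne
    refine Finset.sum_eq_zero fun γ' _ => Finset.sum_eq_zero fun δ' _ => ?_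
    rw [T.bar_vec_ne u v hne]
    simp
  · simp

theorem channel_linearIndependent (u v w x : I) :
    LinearIndependent ℂ (T.channel u v w x) := by
  classical
  rw [Fintype.linearIndependent_iff]
  rintro g hg ⟨z, γ, δ⟩
  have h := congrArg (T.bar w x z γ ≫ ·) hg
  simp only [Preadditive.comp_sum, Limits.comp_zero, Linear.comp_smul, channel,
    Fintype.sum_sigma, Fintype.sum_prod_type, ← Category.assoc] at h
  rw [Finset.sum_eq_single z, Finset.sum_eq_single γ] at h
  · simp only [T.theta1, if_true, Linear.smul_comp, Category.id_comp, smul_smul] at h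
    have h2 := Fintype.linearIndependent_iff.mp (T.bar_linearIndependent u v z) _ h δ
    exact (mul_eq_zero.mp h2).resolve_right (T.normConst_ne_zero w x z)
  · intro γ' _ hne
    refine Finset.sum_eq_zero fun δ' _ => ?_
    rw [T.theta1, if_neg (Ne.symm hne)]
    simp
  · simp
  · intro z' _ hne
    refine Finset.sum_eq_zero fun γ' _ => Finset.sum_eq_zero fun δ' _ => ?_
    rw [T.bar_vec_ne w x (Ne.symm hne)]
    simp
  · simp

/-- The vectors `δ ∘ (γ ⊗ id_w)` form a basis of `Hom((u ⊗ v) ⊗ w, x)`. -/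
def leftTreeBasis (u v w x : I) :
    Module.Basis ((z : I) × (Fin (mult S u v z) × Fin (mult S z w x))) ℂ
      ((S.obj u ⊗ S.obj v) ⊗ S.obj w ⟶ S.obj x) :=
  Module.Basis.mk (T.leftTree_linearIndependent u v w x) fun f _ => T.leftTree_span u v w x f

/-- The vectors `(bar γ ⊗ id_w) ∘ bar δ` form a basis of `Hom(x, (u ⊗ v) ⊗ w)`. -/
def leftCotreeBasis (u v w x : I) :
    Module.Basis ((z : I) × (Fin (mult S u v z) × Fin (mult S z w x))) ℂ
      (S.obj x ⟶ (S.obj u ⊗ S.obj v) ⊗ S.obj w) :=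
  Module.Basis.mk (T.leftCotree_linearIndependent u v w x)
    fun f _ => T.leftCotree_span u v w x f

/-- The vectors `bar δ ∘ γ` form a basis of `Hom(w ⊗ x, u ⊗ v)`. -/
def channelBasis (u v w x : I) :
    Module.Basis ((z : I) × (Fin (mult S w x z) × Fin (mult S u v z))) ℂ
      (S.obj w ⊗ S.obj x ⟶ S.obj u ⊗ S.obj v) :=
  Module.Basis.mk (T.channel_linearIndependent u v w x) fun f _ => T.channel_span u v w x f

/-- The associativity matrix `F^x_{uvw}`, whose entry in row `(z, γ, δ)` and column `(y, α, β)` is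
defined by `β ∘ (id_u ⊗ α) = ∑ F_{zγδ}^{yαβ} δ ∘ (γ ⊗ id_w)`, up to the associator. -/
def F (u v w x : I) :
    Matrix ((z : I) × (Fin (mult S u v z) × Fin (mult S z w x)))
      ((y : I) × (Fin (mult S v w y) × Fin (mult S u y x))) ℂ :=
  fun p q => (T.leftTreeBasis u v w x).repr
    ((α_ (S.obj u) (S.obj v) (S.obj w)).hom ≫ T.rightTree u v w x q) p

/-- The associativity matrix `G^{uvw}_x`, whose entry in row `(z, γ, δ)` and column `(y, α, β)` is
defined by `(id_u ⊗ bar α) ∘ bar β = ∑ G_{zδγ}^{yβα} (bar γ ⊗ id_w) ∘ bar δ`, up to the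
associator. -/
def G (u v w x : I) :
    Matrix ((z : I) × (Fin (mult S u v z) × Fin (mult S z w x)))
      ((y : I) × (Fin (mult S v w y) × Fin (mult S u y x))) ℂ :=
  fun p q => (T.leftCotreeBasis u v w x).repr
    (T.rightCotree u v w x q ≫ (α_ (S.obj u) (S.obj v) (S.obj w)).inv) p

/-- The morphism `(id_u ⊗ β) ∘ (bar α ⊗ id_x) : w ⊗ x ⟶ u ⊗ v` with a middle edge `y` from the
left strand up to the right strand, for `α : u ⊗ y ⟶ w` and `β : y ⊗ x ⟶ v`. -/
def exchangePlus (u v w x : I) (q : (y : I) × (Fin (mult S u y w) × Fin (mult S y x v))) :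
    S.obj w ⊗ S.obj x ⟶ S.obj u ⊗ S.obj v :=
  T.bar u q.1 w q.2.1 ▷ S.obj x ≫ (α_ (S.obj u) (S.obj q.1) (S.obj x)).hom ≫
    S.obj u ◁ T.vec q.1 x v q.2.2

/-- The morphism `(β ⊗ id_v) ∘ (id_w ⊗ bar α) : w ⊗ x ⟶ u ⊗ v` with a middle edge `y` from the
right strand up to the left strand, for `α : y ⊗ v ⟶ x` and `β : w ⊗ y ⟶ u`. -/
def exchangeMinus (u v w x : I) (q : (y : I) × (Fin (mult S y v x) × Fin (mult S w y u))) :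
    S.obj w ⊗ S.obj x ⟶ S.obj u ⊗ S.obj v :=
  S.obj w ◁ T.bar q.1 v x q.2.1 ≫ (α_ (S.obj w) (S.obj q.1) (S.obj v)).inv ≫
    T.vec w q.1 u q.2.2 ▷ S.obj v

/-- The matrix of `(+)6j`-symbols `{u v y(αβ); w x z(γδ)}_+`, with column `(y, α, β)` and row
`(z, γ, δ)`: the coefficients of `exchangePlus` in the basis `bar δ ∘ γ`. -/
def sixJPlus (u v w x : I) :
    Matrix ((z : I) × (Fin (mult S w x z) × Fin (mult S u v z)))
      ((y : I) × (Fin (mult S u y w) × Fin (mult S y x v))) ℂ :=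
  fun p q => (T.channelBasis u v w x).repr (T.exchangePlus u v w x q) p

/-- The matrix of `(-)6j`-symbols `{u v y(αβ); w x z(γδ)}_-`, with column `(y, α, β)` and row
`(z, γ, δ)`: the coefficients of `exchangeMinus` in the basis `bar δ ∘ γ`. -/
def sixJMinus (u v w x : I) :
    Matrix ((z : I) × (Fin (mult S w x z) × Fin (mult S u v z)))
      ((y : I) × (Fin (mult S y v x) × Fin (mult S w y u))) ℂ :=
  fun p q => (T.channelBasis u v w x).repr (T.exchangeMinus u v w x q) p

end TrivalentBasis

end Trivalent

/-- A matrix, with rows and columns indexed by possibly different finite types, is unitary if its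
conjugate transpose is a two-sided inverse. -/
def IsUnitaryMatrix {m n : Type*} [Fintype m] [Fintype n] [DecidableEq m] [DecidableEq n]
    (M : Matrix m n ℂ) : Prop :=
  M.conjTranspose * M = 1 ∧ M * M.conjTranspose = 1

end SphericalFusion

end

/-!
Two bases of trees `δ ∘ (γ ⊗ id)` and cotrees `(bar γ ⊗ id) ∘ bar δ` are dual to each other up to a
constant that depends on the outer labels only. Hence the transpose of `G` is inverse to `F`
(`G_transpose_mul_F`), and `G` is the complex conjugate of `F` when `F` is unitary. Closing up the
defining equations, a `(+)6j`-symbol is an entry of some `F`, and its mirror `(-)6j`-symbol the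
corresponding entry of `G`, both times the same quotient of normalization constants
`√u √v / √x` (`sixJPlus_eq`, `sixJMinus_eq`). It remains to see that this quotient is real where
it matters, and that the `6j`-matrices are unitary. Both follow from a study of how a self-dual
strand is bent.

An isomorphism of a simple object `u` with its dual makes `u` its own dual, so that bending `u` up
or down gives mutually inverse maps between `Hom(u ⊗ y, w)` and `Hom(y, u ⊗ w)`, with matrices `up`
and `down`. Three facts determine these matrices.
* `up u y w` and `down u w y` are inverse to each other, by the zigzag identities.
* `down u y w` is a multiple of the transpose of `down u w y`, with a factor depending on `u` only
  (`exists_down_eq_smul_transpose`): both are traces of the same closed diagram, up to a rotation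
  of the cap on `u ⊗ u`, which changes the cap by a scalar because `u` is simple.
* The entries of `F^y_{uuy}` and `G^{uuy}_y` in the rows through the unit object are those of `up`
  and `down` (`star_up_mul_eq`), so unitarity makes `up` and `down` complex conjugate up to scaling.

Together they show that `down * downᴴ` is a scalar matrix. Its diagonal is positive, and comparison
with the channel `u ⊗ 𝟙_ ⟶ u`, whose constant is `±1`, shows that the scalar depends on `u` only
and that the normalization constants of all nonzero channels are real
(`exists_down_mul_conjTranspose`). The latter gives the mirror symmetry of the `6j`-symbols. For
their unitarity, bend the strand `u` in the defining equation of the `(+)6j`-symbols: it becomes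
the defining equation of `F^v_{uwx}` (`exchangeBend_eq`), so the `(+)6j`-matrix is the inverse of
`F^v_{uwx}`, multiplied on both sides by bending matrices that are unitary up to a scalar and its
inverse.
-/

noncomputable section

namespace SphericalFusion

universe v u

/-! ### Left traces in a pivotal category -/

section LeftTrace

variable {C : Type u} [Category.{v} C] [MonoidalCategory C]

theorem rightDualIso_hom_comp_evaluation {X Y₁ Y₂ : C} (p₁ : ExactPairing X Y₁)
    (p₂ : ExactPairing X Y₂) :
    (rightDualIso p₁ p₂).hom ▷ X ≫ @ExactPairing.evaluation C _ _ X Y₂ p₂ =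
      @ExactPairing.evaluation C _ _ X Y₁ p₁ := by
  have h := @rightAdjointMate_comp_evaluation C _ _ X X ⟨Y₂⟩ ⟨Y₁⟩ (𝟙 X)
  rw [whiskerLeft_id, Category.id_comp] at h
  exact h

theorem coevaluation_comp_leftDualIso_hom {X₁ X₂ Y : C} (p₁ : ExactPairing X₁ Y)
    (p₂ : ExactPairing X₂ Y) :
    @ExactPairing.coevaluation C _ _ X₁ Y p₁ ≫ (leftDualIso p₁ p₂).hom ▷ Y =
      @ExactPairing.coevaluation C _ _ X₂ Y p₂ := by
  have h := @coevaluation_comp_leftAdjointMate C _ _ Y Y ⟨X₂⟩ ⟨X₁⟩ (𝟙 Y)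
  rw [whiskerLeft_id, Category.comp_id] at h
  exact h

variable [PivotalCategory C]

/-- The dual of a morphism, defined by the right duality. -/
def dualMap {X Y : C} (f : X ⟶ Y) : PivotalCategory.dual Y ⟶ PivotalCategory.dual X :=
  @rightAdjointMate C _ _ X Y
    (@HasRightDual.mk C _ _ X (PivotalCategory.dual X) (PivotalCategory.rightPairing X))
    (@HasRightDual.mk C _ _ Y (PivotalCategory.dual Y) (PivotalCategory.rightPairing Y)) f

theorem dualMap_comp_evR {X Y : C} (f : X ⟶ Y) :
    dualMap f ▷ X ≫ evR X = PivotalCategory.dual Y ◁ f ≫ evR Y :=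
  @rightAdjointMate_comp_evaluation C _ _ X Y
    (@HasRightDual.mk C _ _ X _ (PivotalCategory.rightPairing X))
    (@HasRightDual.mk C _ _ Y _ (PivotalCategory.rightPairing Y)) f

theorem coevL_comp_dualMap {X Y : C} (f : X ⟶ Y) :
    coevL Y ≫ dualMap f ▷ Y = coevL X ≫ PivotalCategory.dual X ◁ f := by
  rw [dualMap, PivotalCategory.mate_eq]
  exact @coevaluation_comp_leftAdjointMate C _ _ X Y
    (@HasLeftDual.mk C _ _ X _ (PivotalCategory.leftPairing X))
    (@HasLeftDual.mk C _ _ Y _ (PivotalCategory.leftPairing Y)) f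

/-- Sliding `f` around the loop uses both dualities, and needs that they agree on morphisms. -/
theorem trLeft_comp_comm {X Y : C} (f : X ⟶ Y) (g : Y ⟶ X) :
    trLeft (f ≫ g) = trLeft (g ≫ f) := by
  simp only [trLeft, whiskerLeft_comp, Category.assoc]
  rw [← reassoc_of% coevL_comp_dualMap f, ← whisker_exchange_assoc, dualMap_comp_evR]

/-- The partial left trace over `X` of an endomorphism of `X ⊗ Y`. -/
def partialTrLeft {X Y : C} (h : X ⊗ Y ⟶ X ⊗ Y) : Y ⟶ Y :=
  (λ_ Y).inv ≫ coevL X ▷ Y ≫ (α_ _ _ _).hom ≫ PivotalCategory.dual X ◁ h ≫ (α_ _ _ _).inv ≫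
    evR X ▷ Y ≫ (λ_ Y).hom

/-- The left trace of an endomorphism of `X ⊗ Y` is the left trace of its partial trace, since the
two dualities identify `dual (X ⊗ Y)` with `dual Y ⊗ dual X` in the same way. -/
theorem trLeft_partialTrLeft {X Y : C} (h : X ⊗ Y ⟶ X ⊗ Y) :
    trLeft (partialTrLeft h) = trLeft h := by
  let θ := (rightDualIso (PivotalCategory.rightPairing (X ⊗ Y))
      (@ExactPairing.tensor C _ _ X Y (PivotalCategory.dual X) (PivotalCategory.dual Y)
        (PivotalCategory.rightPairing X) (PivotalCategory.rightPairing Y))).hom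
  have hev : evR (X ⊗ Y) = θ ▷ (X ⊗ Y) ≫
      (𝟙 _ ⊗≫ PivotalCategory.dual Y ◁ (evR X ▷ Y) ⊗≫ evR Y) :=
    (rightDualIso_hom_comp_evaluation _ _).symm
  have hcoev : coevL (X ⊗ Y) ≫ θ ▷ (X ⊗ Y) =
      coevL Y ⊗≫ (PivotalCategory.dual Y ◁ coevL X) ▷ Y ⊗≫ 𝟙 _ := by
    simp only [θ]
    rw [PivotalCategory.tensor_eq]
    exact coevaluation_comp_leftDualIso_hom _ _
  rw [trLeft, trLeft, hev, whisker_exchange_assoc, reassoc_of% hcoev, partialTrLeft]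
  monoidal

/-- Rotating a cap `e` on `X ⊗ X` through the partial trace over one of its legs turns it into
the cap `rotateCap e`. -/
def rotateCap {X : C} (e : X ⊗ X ⟶ 𝟙_ C) : X ⊗ X ⟶ 𝟙_ C :=
  ((λ_ X).inv ≫ coevL X ▷ X ≫ (α_ _ _ _).hom ≫ PivotalCategory.dual X ◁ e ≫ (ρ_ _).hom) ▷ X ≫
    evR X

/-- Bending a leg of `g` down and composing with `f` has, up to rotation of the cap, the same trace
as bending a leg of `f` down and composing with `g`. -/
theorem trLeft_bend_comm {X Y Z : C} (e : X ⊗ X ⟶ 𝟙_ C) (f : Y ⟶ X ⊗ Z) (g : Z ⟶ X ⊗ Y) :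
    trLeft (f ≫ X ◁ g ≫ (α_ _ _ _).inv ≫ e ▷ Y ≫ (λ_ Y).hom) =
      trLeft (g ≫ X ◁ f ≫ (α_ _ _ _).inv ≫ rotateCap e ▷ Z ≫ (λ_ Z).hom) := by
  rw [trLeft_comp_comm, ← trLeft_partialTrLeft]
  congr 1
  rw [partialTrLeft, rotateCap]
  calc
    _ = 𝟙 _ ⊗≫ (coevL X ▷ Z ≫ (PivotalCategory.dual X ⊗ X) ◁ g) ⊗≫
        PivotalCategory.dual X ◁ e ▷ Y ⊗≫ PivotalCategory.dual X ◁ f ⊗≫ evR X ▷ Z ⊗≫ 𝟙 _ := by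
      monoidal
    _ = g ⊗≫ (((λ_ X).inv ≫ coevL X ▷ X ≫ (α_ _ _ _).hom ≫ PivotalCategory.dual X ◁ e ≫
        (ρ_ _).hom) ▷ Y ≫ PivotalCategory.dual X ◁ f) ⊗≫ evR X ▷ Z ⊗≫ 𝟙 _ := by
      rw [← whisker_exchange]; monoidal
    _ = _ := by
      rw [← whisker_exchange]; monoidal

/-- An object isomorphic to its dual is its own right dual. -/
theorem nonempty_exactPairing_self (X : C) (h : Nonempty (X ≅ PivotalCategory.dual X)) :
    Nonempty (ExactPairing X X) := by
  obtain ⟨i⟩ := h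
  let _ := PivotalCategory.rightPairing X
  exact ⟨exactPairingCongrRight i⟩

end LeftTrace

/-! ### Quantum dimensions -/

section QuantumDimension

variable {C : Type u} [Category.{v} C] [Preadditive C] [Linear ℂ C] [MonoidalCategory C]
  [MonoidalPreadditive C] [MonoidalLinear ℂ C] [PivotalCategory C] [IsFusion C]

theorem trLeft_smul_id [IsSpherical C] (X : C) (c : ℂ) :
    trLeft (c • 𝟙 X) = (c * qdim X) • 𝟙 (𝟙_ C) := by
  rw [mul_smul, qdim_smul, IsSpherical.tr_eq]
  simp [trLeft]

/-- The unit has quantum dimension one, because it is isomorphic to its tensor square. -/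
theorem qdim_eq_one_of_iso_unit [IsSpherical C] {X : C} (e : 𝟙_ C ≅ X) : qdim X = 1 := by
  have hX : qdim X = qdim (𝟙_ C) := by
    have h1 := trLeft_smul_id X 1
    have h2 := trLeft_smul_id (𝟙_ C) 1
    rw [one_smul, one_mul] at h1 h2
    apply (IsFusion.unit_simple (C := C)).1
    change qdim X • _ = qdim (𝟙_ C) • _
    rw [← h1, ← h2, ← e.inv_hom_id, trLeft_comp_comm, e.hom_inv_id]
  have hs : qdim (𝟙_ C) * qdim (𝟙_ C) = qdim (𝟙_ C) := by
    have h1 : partialTrLeft (𝟙 (𝟙_ C ⊗ 𝟙_ C)) = qdim (𝟙_ C) • 𝟙 (𝟙_ C) := by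
      have : partialTrLeft (𝟙 (𝟙_ C ⊗ 𝟙_ C)) =
          (λ_ _).inv ≫ trLeft (𝟙 (𝟙_ C)) ▷ 𝟙_ C ≫ (λ_ _).hom := by
        simp [partialTrLeft, trLeft]
      have h2 := trLeft_smul_id (𝟙_ C) 1
      rw [one_smul, one_mul] at h2
      rw [this, h2]
      simp
    have h3 := trLeft_partialTrLeft (𝟙 (𝟙_ C ⊗ 𝟙_ C))
    rw [h1, trLeft_smul_id] at h3
    apply (IsFusion.unit_simple (C := C)).1
    change _ • _ = qdim (𝟙_ C) • _
    rw [h3, ← (λ_ (𝟙_ C)).hom_inv_id, trLeft_comp_comm, (λ_ (𝟙_ C)).inv_hom_id]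
    have h2 := trLeft_smul_id (𝟙_ C) 1
    rwa [one_smul, one_mul] at h2
  rw [hX]
  exact mul_right_cancel₀ (qdim_ne_zero IsFusion.unit_simple) (by rw [hs, one_mul])

end QuantumDimension

/-! ### Bending a strand along an exact pairing -/

section Bend

variable {C : Type u} [Category.{v} C] [Preadditive C] [Linear ℂ C]
  [MonoidalCategory C] [MonoidalPreadditive C] [MonoidalLinear ℂ C]

/-- The bijection `tensorLeftHomEquiv` from `Hom(X, Y ⊗ Z)` to `Hom(Y' ⊗ X, Z)`, as a linear
equivalence. -/
def bendDown (X Y Y' Z : C) [ExactPairing Y Y'] : (X ⟶ Y ⊗ Z) ≃ₗ[ℂ] (Y' ⊗ X ⟶ Z) where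
  __ := (tensorLeftHomEquiv X Y Y' Z).symm
  map_add' f g := by
    simp [tensorLeftHomEquiv, Preadditive.add_comp]
  map_smul' c f := by
    simp [tensorLeftHomEquiv]

variable {X Y Y' Z W : C} [ExactPairing Y Y']

theorem bendDown_apply (f : X ⟶ Y ⊗ Z) :
    bendDown X Y Y' Z f = Y' ◁ f ≫ (α_ _ _ _).inv ≫ ε_ Y Y' ▷ Z ≫ (λ_ Z).hom := rfl

theorem bendDown_symm_apply (f : Y' ⊗ X ⟶ Z) :
    (bendDown X Y Y' Z).symm f = (λ_ X).inv ≫ η_ Y Y' ▷ X ≫ (α_ _ _ _).hom ≫ Y ◁ f := rfl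

theorem bendDown_comp (f : W ⟶ X) (g : X ⟶ Y ⊗ Z) :
    bendDown W Y Y' Z (f ≫ g) = Y' ◁ f ≫ bendDown X Y Y' Z g := by
  simp [bendDown_apply]

/-- Bending down the left strand of an exchange diagram, in which an edge `Z` runs from the left to
the right, yields a left tree. -/
theorem bendDown_exchange {V : C} (f : X ⟶ Y ⊗ Z) (g : Z ⊗ W ⟶ V) :
    bendDown (X ⊗ W) Y Y' V (f ▷ W ≫ (α_ Y Z W).hom ≫ Y ◁ g) =
      (α_ Y' X W).inv ≫ bendDown X Y Y' Z f ▷ W ≫ g := by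
  simp only [bendDown_apply]
  calc
    _ = 𝟙 _ ⊗≫ (Y' ◁ f) ▷ W ⊗≫ ((Y' ⊗ Y) ◁ g ≫ ε_ Y Y' ▷ V) ⊗≫ 𝟙 _ := by monoidal
    _ = _ := by rw [whisker_exchange]; monoidal

end Bend

section SelfDual

variable {C : Type u} [Category.{v} C] [Preadditive C] [Linear ℂ C]
  [MonoidalCategory C] [MonoidalPreadditive C] [MonoidalLinear ℂ C]
  {X : C} [ExactPairing X X]

theorem exists_smul_evaluation (hX : IsSimpleObject X) (g : X ⊗ X ⟶ 𝟙_ C) :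
    ∃ c : ℂ, g = c • ε_ X X := by
  obtain ⟨c, hc⟩ := hX.2 ((bendDown X X X (𝟙_ C)).symm g ≫ (ρ_ X).hom)
  refine ⟨c, ?_⟩
  have h : (bendDown X X X (𝟙_ C)).symm g = c • (ρ_ X).inv := by
    rw [← cancel_mono (ρ_ X).hom, ← hc]; simp
  rw [LinearEquiv.symm_apply_eq, map_smul] at h
  rw [h, bendDown_apply]
  congr 1
  monoidal

theorem exists_smul_coevaluation (hX : IsSimpleObject X) (g : 𝟙_ C ⟶ X ⊗ X) :
    ∃ c : ℂ, g = c • η_ X X := by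
  obtain ⟨c, hc⟩ := hX.2 ((ρ_ X).inv ≫ bendDown (𝟙_ C) X X X g)
  refine ⟨c, ?_⟩
  have h : bendDown (𝟙_ C) X X X g = c • (ρ_ X).hom := by
    rw [← cancel_epi (ρ_ X).inv, ← hc]; simp
  rw [← LinearEquiv.eq_symm_apply, map_smul] at h
  rw [h, bendDown_symm_apply]
  congr 1
  monoidal

end SelfDual

/-! ### Coefficients with respect to the tree bases -/

section Coefficients

variable {C : Type u} [Category.{v} C] [Preadditive C] [Linear ℂ C] [MonoidalCategory C]
  {I : Type*} {S : SimpleReps C I}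
  [MonoidalPreadditive C] [MonoidalLinear ℂ C] [PivotalCategory C] [IsFusion C]

theorem SimpleReps.smul_id_injective (S : SimpleReps C I) (x : I) {c d : ℂ}
    (h : c • 𝟙 (S.obj x) = d • 𝟙 (S.obj x)) : c = d :=
  (S.simple x).1 h

namespace TrivalentBasis

variable (T : TrivalentBasis S)

theorem bar_comp_vec (u v x : I) (α β : Fin (mult S u v x)) :
    T.bar u v x α ≫ T.vec u v x β = if α = β then T.normConst u v x • 𝟙 (S.obj x) else 0 :=
  T.theta1 u v x α β

theorem bar_comp (u v x : I) (α : Fin (mult S u v x)) (f : S.obj u ⊗ S.obj v ⟶ S.obj x) :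
    T.bar u v x α ≫ f = ((T.vec u v x).repr f α * T.normConst u v x) • 𝟙 (S.obj x) := by
  have h : T.bar u v x α ≫ (∑ β, (T.vec u v x).repr f β • T.vec u v x β) =
      ((T.vec u v x).repr f α * T.normConst u v x) • 𝟙 (S.obj x) := by
    simp [-Module.Basis.sum_repr, Preadditive.comp_sum, bar_comp_vec, smul_smul]
  rwa [(T.vec u v x).sum_repr f] at h

variable [Fintype I]

theorem comp_vec (u v x : I) (α : Fin (mult S u v x)) (f : S.obj x ⟶ S.obj u ⊗ S.obj v) :
    f ≫ T.vec u v x α = ((T.barBasis u v x).repr f α * T.normConst u v x) • 𝟙 (S.obj x) := by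
  have h : (∑ β, (T.barBasis u v x).repr f β • T.barBasis u v x β) ≫ T.vec u v x α =
      ((T.barBasis u v x).repr f α * T.normConst u v x) • 𝟙 (S.obj x) := by
    simp [-Module.Basis.sum_repr, Preadditive.sum_comp, barBasis_apply, bar_comp_vec, smul_smul]
  rwa [(T.barBasis u v x).sum_repr f] at h

/-- The normalization constant `√u √v √w / √x` of a tree with leaves `u`, `v`, `w` and root `x`;
it does not depend on the inner edge. -/
def treeConst (u v w x : I) : ℂ := T.sqrtDim u * T.sqrtDim v * T.sqrtDim w / T.sqrtDim x

theorem treeConst_ne_zero (u v w x : I) : T.treeConst u v w x ≠ 0 :=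
  div_ne_zero (mul_ne_zero (mul_ne_zero (T.sqrtDim_ne_zero u) (T.sqrtDim_ne_zero v))
    (T.sqrtDim_ne_zero w)) (T.sqrtDim_ne_zero x)

theorem normConst_mul_left (u v w x z : I) :
    T.normConst u v z * T.normConst z w x = T.treeConst u v w x := by
  have := T.sqrtDim_ne_zero z
  have := T.sqrtDim_ne_zero x
  simp only [normConst, treeConst]
  field_simp

theorem normConst_mul_right (u v w x y : I) :
    T.normConst v w y * T.normConst u y x = T.treeConst u v w x := by
  have := T.sqrtDim_ne_zero y
  have := T.sqrtDim_ne_zero x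
  simp only [normConst, treeConst]
  field_simp

variable [DecidableEq I]

theorem leftCotree_comp_leftTree (u v w x : I)
    (p q : (z : I) × (Fin (mult S u v z) × Fin (mult S z w x))) :
    T.leftCotree u v w x p ≫ T.leftTree u v w x q =
      if p = q then T.treeConst u v w x • 𝟙 (S.obj x) else 0 := by
  obtain ⟨z, γ, δ⟩ := p
  obtain ⟨z', γ', δ'⟩ := q
  simp only [leftCotree, leftTree, Category.assoc, ← comp_whiskerRight_assoc]
  by_cases hz : z = z'
  · subst hz
    rw [bar_comp_vec]
    by_cases hγ : γ = γ'
    · subst hγ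
      by_cases hδ : δ = δ'
      · subst hδ
        simp [bar_comp_vec, smul_smul, normConst_mul_left]
      · simp [bar_comp_vec, hδ]
    · simp [hγ]
  · rw [T.bar_vec_ne u v hz]
    simp [hz]

theorem rightCotree_comp_rightTree (u v w x : I)
    (p q : (y : I) × (Fin (mult S v w y) × Fin (mult S u y x))) :
    T.rightCotree u v w x p ≫ T.rightTree u v w x q =
      if p = q then T.treeConst u v w x • 𝟙 (S.obj x) else 0 := by
  obtain ⟨z, γ, δ⟩ := p
  obtain ⟨z', γ', δ'⟩ := q
  simp only [rightCotree, rightTree, Category.assoc, ← whiskerLeft_comp_assoc]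
  by_cases hz : z = z'
  · subst hz
    rw [bar_comp_vec]
    by_cases hγ : γ = γ'
    · subst hγ
      by_cases hδ : δ = δ'
      · subst hδ
        simp [bar_comp_vec, smul_smul, normConst_mul_right]
      · simp [bar_comp_vec, hδ]
    · simp [hγ]
  · rw [T.bar_vec_ne v w hz]
    simp [hz]

theorem leftCotree_comp (u v w x : I)
    (p : (z : I) × (Fin (mult S u v z) × Fin (mult S z w x)))
    (f : (S.obj u ⊗ S.obj v) ⊗ S.obj w ⟶ S.obj x) :
    T.leftCotree u v w x p ≫ f =
      ((T.leftTreeBasis u v w x).repr f p * T.treeConst u v w x) • 𝟙 (S.obj x) := by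
  conv_lhs => rw [← (T.leftTreeBasis u v w x).sum_repr f]
  simp [Preadditive.comp_sum, leftTreeBasis, leftCotree_comp_leftTree, smul_smul]

theorem comp_leftTree (u v w x : I)
    (p : (z : I) × (Fin (mult S u v z) × Fin (mult S z w x)))
    (f : S.obj x ⟶ (S.obj u ⊗ S.obj v) ⊗ S.obj w) :
    f ≫ T.leftTree u v w x p =
      ((T.leftCotreeBasis u v w x).repr f p * T.treeConst u v w x) • 𝟙 (S.obj x) := by
  conv_lhs => rw [← (T.leftCotreeBasis u v w x).sum_repr f]
  simp [Preadditive.sum_comp, leftCotreeBasis, leftCotree_comp_leftTree, smul_smul]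

theorem bar_comp_comp_vec (u v w x : I)
    (p : (z : I) × (Fin (mult S w x z) × Fin (mult S u v z)))
    (f : S.obj w ⊗ S.obj x ⟶ S.obj u ⊗ S.obj v) :
    T.bar w x p.1 p.2.1 ≫ f ≫ T.vec u v p.1 p.2.2 =
      ((T.channelBasis u v w x).repr f p * (T.normConst w x p.1 * T.normConst u v p.1)) •
        𝟙 (S.obj p.1) := by
  conv_lhs => rw [← (T.channelBasis u v w x).sum_repr f]
  generalize (T.channelBasis u v w x).repr f = c
  obtain ⟨z, γ, δ⟩ := p
  simp only [channelBasis, Module.Basis.coe_mk, Preadditive.sum_comp, Preadditive.comp_sum,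
    Linear.smul_comp, Linear.comp_smul, channel, Category.assoc]
  rw [Finset.sum_eq_single ⟨z, γ, δ⟩]
  · rw [bar_comp_vec, if_pos rfl, ← Category.assoc, bar_comp_vec, if_pos rfl]
    simp [smul_smul, mul_comm]
  · rintro ⟨z', γ', δ'⟩ - hne
    by_cases hz : z' = z
    · subst hz
      rw [bar_comp_vec, ← Category.assoc, bar_comp_vec]
      by_cases hδ : δ' = δ
      · have hγ : γ ≠ γ' := fun h => hne (by rw [h, hδ])
        simp [hγ]
      · simp [hδ]
    · rw [T.bar_vec_ne u v hz]
      simp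
  · simp

/-- The entries of `F` as evaluations of closed-up trees. -/
theorem leftCotree_comp_associator_comp_rightTree (u v w x : I)
    (p : (z : I) × (Fin (mult S u v z) × Fin (mult S z w x)))
    (q : (y : I) × (Fin (mult S v w y) × Fin (mult S u y x))) :
    T.leftCotree u v w x p ≫ (α_ _ _ _).hom ≫ T.rightTree u v w x q =
      (T.F u v w x p q * T.treeConst u v w x) • 𝟙 (S.obj x) :=
  T.leftCotree_comp u v w x p _

/-- The entries of `G` as evaluations of closed-up trees. -/
theorem rightCotree_comp_associator_comp_leftTree (u v w x : I)
    (p : (z : I) × (Fin (mult S u v z) × Fin (mult S z w x)))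
    (q : (y : I) × (Fin (mult S v w y) × Fin (mult S u y x))) :
    T.rightCotree u v w x q ≫ (α_ _ _ _).inv ≫ T.leftTree u v w x p =
      (T.G u v w x p q * T.treeConst u v w x) • 𝟙 (S.obj x) := by
  rw [← Category.assoc]
  exact T.comp_leftTree u v w x p _

theorem rightTree_eq_sum (u v w x : I)
    (q : (y : I) × (Fin (mult S v w y) × Fin (mult S u y x))) :
    T.rightTree u v w x q =
      ∑ p, T.F u v w x p q • ((α_ _ _ _).inv ≫ T.leftTree u v w x p) := by
  have h := (T.leftTreeBasis u v w x).sum_repr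
    ((α_ (S.obj u) (S.obj v) (S.obj w)).hom ≫ T.rightTree u v w x q)
  rw [← Iso.inv_hom_id_assoc (α_ (S.obj u) (S.obj v) (S.obj w)) (T.rightTree u v w x q), ← h,
    Preadditive.comp_sum]
  simp only [Linear.comp_smul, leftTreeBasis, Module.Basis.coe_mk]
  rfl

/-- The transpose of `G` is inverse to `F`: trees and cotrees are dual bases, up to a constant that
depends on the outer labels only. -/
theorem G_transpose_mul_F (u v w x : I) : (T.G u v w x).transpose * T.F u v w x = 1 := by
  ext q q'
  have h := T.rightCotree_comp_rightTree u v w x q q'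
  rw [T.rightTree_eq_sum u v w x q', Preadditive.comp_sum] at h
  simp only [Linear.comp_smul, rightCotree_comp_associator_comp_leftTree, smul_smul,
    ← Finset.sum_smul] at h
  rw [Matrix.mul_apply, Matrix.one_apply]
  apply mul_right_cancel₀ (T.treeConst_ne_zero u v w x)
  apply S.smul_id_injective x
  rw [Finset.sum_mul]
  simp only [Matrix.transpose_apply, ite_mul, one_mul, zero_mul, ite_smul, zero_smul]
  rw [← h]
  congr 1
  exact Finset.sum_congr rfl fun p _ => by ring

theorem G_eq_star_F {u v w x : I} (hF : IsUnitaryMatrix (T.F u v w x))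
    (p : (z : I) × (Fin (mult S u v z) × Fin (mult S z w x)))
    (q : (y : I) × (Fin (mult S v w y) × Fin (mult S u y x))) :
    T.G u v w x p q = star (T.F u v w x p q) := by
  have h : (T.G u v w x).transpose = (T.F u v w x).conjTranspose := by
    rw [← Matrix.mul_one (T.G u v w x).transpose, ← hF.2, ← Matrix.mul_assoc,
      G_transpose_mul_F, Matrix.one_mul]
  exact congrFun (congrFun h q) p

theorem bar_comp_exchangePlus_comp_vec (u v w x z y : I) (γ : Fin (mult S w x z))
    (δ : Fin (mult S u v z)) (α : Fin (mult S u y w)) (β : Fin (mult S y x v)) :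
    T.bar w x z γ ≫ T.exchangePlus u v w x ⟨y, α, β⟩ ≫ T.vec u v z δ =
      (T.sixJPlus u v w x ⟨z, γ, δ⟩ ⟨y, α, β⟩ * (T.normConst w x z * T.normConst u v z)) •
        𝟙 (S.obj z) :=
  T.bar_comp_comp_vec u v w x ⟨z, γ, δ⟩ _

theorem bar_comp_exchangeMinus_comp_vec (u v w x z y : I) (γ : Fin (mult S w x z))
    (δ : Fin (mult S u v z)) (α : Fin (mult S y v x)) (β : Fin (mult S w y u)) :
    T.bar w x z γ ≫ T.exchangeMinus u v w x ⟨y, α, β⟩ ≫ T.vec u v z δ =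
      (T.sixJMinus u v w x ⟨z, γ, δ⟩ ⟨y, α, β⟩ * (T.normConst w x z * T.normConst u v z)) •
        𝟙 (S.obj z) :=
  T.bar_comp_comp_vec u v w x ⟨z, γ, δ⟩ _

/-- Closing the two sides of the defining equation of a `(+)6j`-symbol to a morphism `z ⟶ z`
turns it into an entry of `F`. -/
theorem sixJPlus_eq (u v w x z y : I) (γ : Fin (mult S w x z)) (δ : Fin (mult S u v z))
    (α : Fin (mult S u y w)) (β : Fin (mult S y x v)) :
    T.sixJPlus u v w x ⟨z, γ, δ⟩ ⟨y, α, β⟩ =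
      T.F u y x z ⟨w, α, γ⟩ ⟨v, β, δ⟩ * (T.normConst y x v / T.normConst w x z) := by
  have h : T.bar w x z γ ≫ T.exchangePlus u v w x ⟨y, α, β⟩ ≫ T.vec u v z δ =
      T.leftCotree u y x z ⟨w, α, γ⟩ ≫ (α_ _ _ _).hom ≫ T.rightTree u y x z ⟨v, β, δ⟩ := by
    simp only [exchangePlus, leftCotree, rightTree, Category.assoc]
  rw [bar_comp_exchangePlus_comp_vec, leftCotree_comp_associator_comp_rightTree] at h
  replace h := S.smul_id_injective z h
  rw [← T.normConst_mul_right u y x z v, ← mul_assoc, ← mul_assoc] at h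
  rw [← mul_div_assoc, eq_div_iff (T.normConst_ne_zero w x z)]
  exact mul_right_cancel₀ (T.normConst_ne_zero u v z) h

/-- Closing the two sides of the defining equation of a `(-)6j`-symbol to a morphism `z ⟶ z`
turns it into an entry of `G`. -/
theorem sixJMinus_eq (u v w x z y : I) (γ : Fin (mult S w x z)) (δ : Fin (mult S u v z))
    (α : Fin (mult S u y w)) (β : Fin (mult S y x v)) :
    T.sixJMinus w x u v ⟨z, δ, γ⟩ ⟨y, β, α⟩ =
      T.G u y x z ⟨w, α, γ⟩ ⟨v, β, δ⟩ * (T.normConst y x v / T.normConst w x z) := by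
  have h : T.bar u v z δ ≫ T.exchangeMinus w x u v ⟨y, β, α⟩ ≫ T.vec w x z γ =
      T.rightCotree u y x z ⟨v, β, δ⟩ ≫ (α_ _ _ _).inv ≫ T.leftTree u y x z ⟨w, α, γ⟩ := by
    simp only [exchangeMinus, rightCotree, leftTree, Category.assoc]
  rw [bar_comp_exchangeMinus_comp_vec, rightCotree_comp_associator_comp_leftTree] at h
  replace h := S.smul_id_injective z h
  rw [← T.normConst_mul_right u y x z v, mul_comm (T.normConst u v z), ← mul_assoc,
    ← mul_assoc] at h
  rw [← mul_div_assoc, eq_div_iff (T.normConst_ne_zero w x z)]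
  exact mul_right_cancel₀ (T.normConst_ne_zero u v z) h

end TrivalentBasis

end Coefficients

/-! ### Bending matrices -/

section BendMatrix

variable {C : Type u} [Category.{v} C] [Preadditive C] [Linear ℂ C] [MonoidalCategory C]
  {I : Type*} {S : SimpleReps C I}
  [MonoidalPreadditive C] [MonoidalLinear ℂ C] [PivotalCategory C] [IsFusion C]

namespace TrivalentBasis

variable (T : TrivalentBasis S) [∀ u, ExactPairing (S.obj u) (S.obj u)]

/-- The matrix of the map `Hom(w, u ⊗ y) → Hom(u ⊗ w, y)` bending the strand `u` down, with respect
to the bases `bar` and `vec`; rows are indexed by the source. -/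
def down (u y w : I) : Matrix (Fin (mult S u y w)) (Fin (mult S u w y)) ℂ :=
  fun α β => (T.vec u w y).repr
    (bendDown (S.obj w) (S.obj u) (S.obj u) (S.obj y) (T.bar u y w α)) β

theorem bendDown_bar (u y w : I) (α : Fin (mult S u y w)) :
    bendDown (S.obj w) (S.obj u) (S.obj u) (S.obj y) (T.bar u y w α) =
      ∑ β, T.down u y w α β • T.vec u w y β :=
  ((T.vec u w y).sum_repr _).symm

variable [Fintype I]

/-- The matrix of the map `Hom(u ⊗ y, w) → Hom(y, u ⊗ w)` bending the strand `u` up, with respect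
to the bases `vec` and `bar`; rows are indexed by the source. -/
def up (u y w : I) : Matrix (Fin (mult S u y w)) (Fin (mult S u w y)) ℂ :=
  fun α β => (T.barBasis u w y).repr
    ((bendDown (S.obj y) (S.obj u) (S.obj u) (S.obj w)).symm (T.vec u y w α)) β

theorem bendDown_symm_vec (u y w : I) (α : Fin (mult S u y w)) :
    (bendDown (S.obj y) (S.obj u) (S.obj u) (S.obj w)).symm (T.vec u y w α) =
      ∑ β, T.up u y w α β • T.bar u w y β := by
  simp only [← barBasis_apply]
  exact ((T.barBasis u w y).sum_repr _).symm

theorem up_mul_down (u y w : I) : T.up u y w * T.down u w y = 1 := by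
  ext α α'
  have h := congrArg (bendDown (S.obj y) (S.obj u) (S.obj u) (S.obj w))
    (T.bendDown_symm_vec u y w α)
  simp only [LinearEquiv.apply_symm_apply, map_sum, map_smul, bendDown_bar, Finset.smul_sum,
    smul_smul] at h
  rw [Finset.sum_comm] at h
  simp only [← Finset.sum_smul] at h
  have h2 := congrArg (fun f => (T.vec u y w).repr f α') h
  rw [Matrix.mul_apply, Matrix.one_apply]
  simp only [map_sum, map_smul, Module.Basis.repr_self, Finsupp.coe_finsetSum,
    Finset.sum_apply, Finsupp.coe_smul, Pi.smul_apply, smul_eq_mul, Finsupp.single_apply,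
    mul_ite, mul_one, mul_zero, Finset.sum_ite_eq', Finset.mem_univ, if_true] at h2
  exact h2.symm

theorem bar_comp_bendDown (u y w : I) (α : Fin (mult S u y w)) (β : Fin (mult S u w y)) :
    T.bar u w y β ≫ bendDown (S.obj w) (S.obj u) (S.obj u) (S.obj y) (T.bar u y w α) =
      (T.down u y w α β * T.normConst u w y) • 𝟙 (S.obj y) :=
  T.bar_comp u w y β _

theorem bendDown_symm_comp_vec (u y w : I) (α : Fin (mult S u y w)) (β : Fin (mult S u w y)) :
    (bendDown (S.obj y) (S.obj u) (S.obj u) (S.obj w)).symm (T.vec u y w α) ≫ T.vec u w y β =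
      (T.up u y w α β * T.normConst u w y) • 𝟙 (S.obj y) :=
  T.comp_vec u w y β _

/-- Rotating the cap on `u ⊗ u` multiplies it by a scalar, which compares the bending matrix for
`(y, w)` with the transposed bending matrix for `(w, y)`. -/
theorem exists_down_eq_smul_transpose [IsSpherical C] (u : I) :
    ∃ t : ℂ, ∀ y w, T.down u y w = t • (T.down u w y).transpose := by
  obtain ⟨t, ht⟩ := exists_smul_evaluation (S.simple u) (rotateCap (ε_ (S.obj u) (S.obj u)))
  refine ⟨t, fun y w => ?_⟩
  ext α β
  have h := trLeft_bend_comm (ε_ (S.obj u) (S.obj u)) (T.bar u w y β) (T.bar u y w α)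
  rw [ht] at h
  simp only [MonoidalLinear.smul_whiskerRight, Linear.smul_comp, Linear.comp_smul] at h
  simp only [← bendDown_apply, bar_comp_bendDown, smul_smul, trLeft_smul_id] at h
  have h2 := (IsFusion.unit_simple (C := C)).1 h
  rw [← T.sqrtDim_sq, ← T.sqrtDim_sq] at h2
  have e1 := T.sqrtDim_ne_zero u
  have e2 := T.sqrtDim_ne_zero y
  have e3 := T.sqrtDim_ne_zero w
  simp only [normConst] at h2
  field_simp at h2
  simpa [mul_comm] using h2

end TrivalentBasis

end BendMatrix

/-! ### Unitarity of the bending matrices -/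

section BendUnitary

variable {C : Type u} [Category.{v} C] [Preadditive C] [Linear ℂ C] [MonoidalCategory C]
  {I : Type*} {S : SimpleReps C I}
  [MonoidalPreadditive C] [MonoidalLinear ℂ C] [PivotalCategory C] [IsFusion C]

namespace TrivalentBasis

variable (T : TrivalentBasis S)

theorem exists_vec_eq_smul_iso {u v x : I} (i : S.obj u ⊗ S.obj v ≅ S.obj x) :
    ∃ (k : Fin (mult S u v x)) (μ μ' : ℂ), T.vec u v x k = μ • i.hom ∧
      T.bar u v x k = μ' • i.inv ∧ μ * μ' = T.normConst u v x := by
  have hne : i.hom ≠ 0 := fun h =>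
    (S.simple x).id_ne_zero (by rw [← i.inv_hom_id, h, Limits.comp_zero])
  have : Nontrivial (S.obj u ⊗ S.obj v ⟶ S.obj x) := ⟨⟨_, _, hne⟩⟩
  obtain ⟨k⟩ := (T.vec u v x).index_nonempty
  obtain ⟨μ, hμ⟩ := (S.simple x).exists_smul (i.inv ≫ T.vec u v x k)
  obtain ⟨μ', hμ'⟩ := (S.simple x).exists_smul (T.bar u v x k ≫ i.hom)
  have h1 : T.vec u v x k = μ • i.hom := by
    rw [← cancel_epi i.inv, hμ]; simp
  have h2 : T.bar u v x k = μ' • i.inv := by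
    rw [← cancel_mono i.hom, hμ']; simp
  refine ⟨k, μ, μ', h1, h2, ?_⟩
  have h := T.bar_comp_vec u v x k k
  rw [if_pos rfl, h1, h2] at h
  simp only [Linear.smul_comp, Linear.comp_smul, Iso.inv_hom_id, smul_smul] at h
  exact S.smul_id_injective x h

theorem exists_vec_eq_smul_evaluation (u : I) [ExactPairing (S.obj u) (S.obj u)] {o : I}
    (e : 𝟙_ C ≅ S.obj o) :
    ∃ (k : Fin (mult S u u o)) (a b : ℂ), b ≠ 0 ∧
      T.vec u u o k = a • (ε_ (S.obj u) (S.obj u) ≫ e.hom) ∧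
      T.bar u u o k = b • (e.inv ≫ η_ (S.obj u) (S.obj u)) := by
  have hε : ε_ (S.obj u) (S.obj u) ≠ 0 := fun h => by
    have hz := ExactPairing.evaluation_coevaluation (S.obj u) (S.obj u)
    rw [h, MonoidalPreadditive.whiskerLeft_zero, Limits.comp_zero, Limits.comp_zero] at hz
    apply (S.simple u).id_ne_zero
    calc 𝟙 (S.obj u) = (λ_ _).inv ≫ ((λ_ _).hom ≫ (ρ_ _).inv) ≫ (ρ_ _).hom := by simp
      _ = 0 := by rw [← hz]; simp
  have hne : ε_ (S.obj u) (S.obj u) ≫ e.hom ≠ 0 := fun h =>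
    hε (by rw [← cancel_mono e.hom, h, Limits.zero_comp])
  have : Nontrivial (S.obj u ⊗ S.obj u ⟶ S.obj o) := ⟨⟨_, _, hne⟩⟩
  obtain ⟨k⟩ := (T.vec u u o).index_nonempty
  obtain ⟨a, ha⟩ := exists_smul_evaluation (S.simple u) (T.vec u u o k ≫ e.inv)
  obtain ⟨b, hb⟩ := exists_smul_coevaluation (S.simple u) (e.hom ≫ T.bar u u o k)
  have h1 : T.vec u u o k = a • (ε_ (S.obj u) (S.obj u) ≫ e.hom) := by
    rw [← cancel_mono e.inv, ha]; simp
  have h2 : T.bar u u o k = b • (e.inv ≫ η_ (S.obj u) (S.obj u)) := by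
    rw [← cancel_epi e.hom, hb]; simp
  refine ⟨k, a, b, ?_, h1, h2⟩
  rintro rfl
  rw [zero_smul] at h2
  have h := T.bar_comp_vec u u o k k
  rw [if_pos rfl, h2, Limits.zero_comp] at h
  exact (smul_ne_zero (T.normConst_ne_zero u u o) (S.simple o).id_ne_zero) h.symm

/-- The left unitor of `y`, read through an identification of `𝟙_` with the object `o`. -/
def unitorIso {o : I} (e : 𝟙_ C ≅ S.obj o) (y : I) : S.obj o ⊗ S.obj y ≅ S.obj y :=
  whiskerRightIso e.symm (S.obj y) ≪≫ λ_ (S.obj y)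

variable [Fintype I] [DecidableEq I]

/-- Unitarity of `F` forces the basis vectors of `Hom(o ⊗ y, y)`, for `o` isomorphic to the unit, to
be multiples of the left unitor by scalars whose absolute value does not depend on `y`: by the
triangle identity, the ratio of two such scalars is the only nonzero entry in a column of `F`. -/
theorem mul_star_eq_of_unitor {o u v w : I} (e : 𝟙_ C ≅ S.obj o)
    (hF : IsUnitaryMatrix (T.F o u v w)) (α : Fin (mult S u v w))
    {k : Fin (mult S o u u)} {l : Fin (mult S o w w)} {μ ν : ℂ} (hμ : μ ≠ 0)
    (hk : T.vec o u u k = μ • (unitorIso e u).hom) (hl : T.vec o w w l = ν • (unitorIso e w).hom) :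
    ν * star ν = μ * star μ := by
  have h : (α_ _ _ _).hom ≫ T.rightTree o u v w ⟨w, α, l⟩ =
      (ν / μ) • T.leftTreeBasis o u v w ⟨u, k, α⟩ := by
    simp only [rightTree, leftTree, leftTreeBasis, Module.Basis.coe_mk, hk, hl, unitorIso,
      Linear.comp_smul, Linear.smul_comp, MonoidalLinear.smul_whiskerRight, smul_smul]
    rw [div_mul_cancel₀ _ hμ]
    congr 1
    simp only [Iso.trans_hom, whiskerRightIso_hom, Iso.symm_hom, comp_whiskerRight,
      Category.assoc]
    rw [whisker_exchange_assoc]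
    monoidal
  have hcol : ∀ p, T.F o u v w p ⟨w, α, l⟩ = if p = ⟨u, k, α⟩ then ν / μ else 0 := by
    intro p
    rw [F, h, map_smul, Module.Basis.repr_self]
    simp [Finsupp.single_apply, eq_comm]
  have h1 := congrFun (congrFun hF.1 ⟨w, α, l⟩) ⟨w, α, l⟩
  rw [Matrix.mul_apply, Matrix.one_apply_eq] at h1
  simp only [Matrix.conjTranspose_apply, hcol, mul_ite, mul_zero, Finset.sum_ite_eq',
    Finset.mem_univ, if_true, star_div₀] at h1
  have hμ' : star μ ≠ 0 := star_ne_zero.mpr hμ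
  field_simp at h1
  linear_combination h1

variable [∀ u, ExactPairing (S.obj u) (S.obj u)]

/-- The entries of `F` in the rows through the unit object are, up to scaling, the entries of the
matrices `up`; likewise `G` and `down`. Mirror conjugate symmetry of `F` thus relates the two. -/
theorem star_up_mul_eq {o u w y : I} (e : 𝟙_ C ≅ S.obj o) (hF : IsUnitaryMatrix (T.F u u y y))
    {k : Fin (mult S u u o)} {a b : ℂ} (ha : T.vec u u o k = a • (ε_ (S.obj u) (S.obj u) ≫ e.hom))
    (hb : T.bar u u o k = b • (e.inv ≫ η_ (S.obj u) (S.obj u)))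
    {l : Fin (mult S o y y)} {μ μ' : ℂ} (hμ : T.vec o y y l = μ • (unitorIso e y).hom)
    (hμ' : T.bar o y y l = μ' • (unitorIso e y).inv)
    (α : Fin (mult S u y w)) (β : Fin (mult S u w y)) :
    star (b * μ' * (T.up u y w α β * T.normConst u w y)) * T.treeConst u u y y =
      a * μ * (T.down u y w α β * T.normConst u w y) * star (T.treeConst u u y y) := by
  have hup : b * μ' * (T.up u y w α β * T.normConst u w y) =
      T.F u u y y ⟨o, k, l⟩ ⟨w, α, β⟩ * T.treeConst u u y y := by
    apply S.smul_id_injective y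
    rw [← leftCotree_comp_associator_comp_rightTree, mul_smul, ← bendDown_symm_comp_vec,
      leftCotree, rightTree, hb, hμ', bendDown_symm_apply]
    simp [unitorIso, smul_smul]
  have hdown : a * μ * (T.down u y w α β * T.normConst u w y) =
      T.G u u y y ⟨o, k, l⟩ ⟨w, α, β⟩ * T.treeConst u u y y := by
    apply S.smul_id_injective y
    rw [← rightCotree_comp_associator_comp_leftTree, mul_smul, ← bar_comp_bendDown,
      rightCotree, leftTree, ha, hμ, bendDown_apply]
    simp [unitorIso, smul_smul, mul_comm]
  rw [hup, hdown, T.G_eq_star_F hF, star_mul']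
  ring

variable [IsSpherical C]

/-- All matrices `down u y w` are unitary up to a common scalar, and the normalization constants of
nonzero fusion channels are real. Here `up * downᵀ` is a scalar by the zigzag and trace identities,
and `up` is a multiple of the complex conjugate of `down`, so `down * downᴴ` is a scalar matrix;
positivity of its diagonal determines the phases of the normalization constants. -/
theorem exists_down_mul_conjTranspose
    (hF : ∀ u v w x : I, IsUnitaryMatrix (T.F u v w x)) (u : I) :
    ∃ c : ℂ, c ≠ 0 ∧ ∀ y w, T.down u y w * (T.down u y w).conjTranspose = c • 1 ∧
      (Fin (mult S u y w) → star (T.normConst u w y) = T.normConst u w y) := by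
  obtain ⟨o, ⟨e⟩⟩ := S.complete (𝟙_ C) IsFusion.unit_simple
  obtain ⟨k, a, b, hb0, ha, hb⟩ := T.exists_vec_eq_smul_evaluation u e
  choose l μ μ' hμ hμ' hμμ' using fun y => T.exists_vec_eq_smul_iso (unitorIso e y)
  have hN : ∀ y, T.normConst o y y = T.sqrtDim o := fun y =>
    mul_div_cancel_right₀ _ (T.sqrtDim_ne_zero y)
  have hr0 := T.sqrtDim_ne_zero o
  have hr : star (T.sqrtDim o) = T.sqrtDim o := by
    have h := T.sqrtDim_sq o
    rw [qdim_eq_one_of_iso_unit e, sq_eq_one_iff] at h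
    rcases h with h | h <;> rw [h] <;> simp
  have hμ0 : ∀ y, μ y ≠ 0 := fun y h => by
    have h1 := hμμ' y
    rw [h, zero_mul, hN] at h1
    exact hr0 h1.symm
  have hμ0' : ∀ y, μ' y ≠ 0 := fun y h => by
    have h1 := hμμ' y
    rw [h, mul_zero, hN] at h1
    exact hr0 h1.symm
  have hm : ∀ y, μ y * star (μ y) = μ o * star (μ o) := fun y => by
    obtain ⟨j, -⟩ := T.exists_vec_eq_smul_evaluation y e
    exact (T.mul_star_eq_of_unitor e (hF o y y o) j (hμ0 y) (hμ y) (hμ o)).symm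
  -- `up` and `down` are complex conjugate up to a scalar `κ` that depends on `u` only.
  obtain ⟨κ, hκ⟩ : ∃ κ : ℂ, ∀ y w (α : Fin (mult S u y w)) (β : Fin (mult S u w y)),
      star (T.up u y w α β) * star (T.normConst u w y) =
        κ * T.normConst u w y * T.down u y w α β := by
    have hs0 := T.sqrtDim_ne_zero u
    refine ⟨a * (μ o * star (μ o)) * star (T.sqrtDim u ^ 2) /
      (T.sqrtDim u ^ 2 * star b * T.sqrtDim o), fun y w α β => ?_⟩
    have h := T.star_up_mul_eq e (hF u u y y) ha hb (hμ y) (hμ' y) α β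
    have hK : T.treeConst u u y y = T.sqrtDim u ^ 2 := by
      have := T.sqrtDim_ne_zero y
      simp only [treeConst]
      field_simp
    have h1 : star (μ y) * star (μ' y) = T.sqrtDim o := by
      rw [← star_mul', hμμ', hN, hr]
    have hb0' : star b ≠ 0 := star_ne_zero.mpr hb0
    have hμs : star (μ' y) ≠ 0 := star_ne_zero.mpr (hμ0' y)
    have hμt : star (μ y) ≠ 0 := star_ne_zero.mpr (hμ0 y)
    rw [hK] at h
    simp only [star_mul'] at h
    rw [← hm y, ← h1]
    field_simp
    linear_combination h
  obtain ⟨t, ht⟩ := T.exists_down_eq_smul_transpose u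
  have key : ∀ y w (α α' : Fin (mult S u y w)),
      star t * κ * T.normConst u w y *
        (T.down u y w * (T.down u y w).conjTranspose) α α' =
      star (T.normConst u w y) * (1 : Matrix _ _ ℂ) α α' := by
    intro y w α α'
    have h := congrArg star (congrFun (congrFun (T.up_mul_down u y w) α) α')
    rw [ht w y, Matrix.mul_apply, star_sum] at h
    have h1 : star ((1 : Matrix (Fin (mult S u y w)) (Fin (mult S u y w)) ℂ) α α') =
        (1 : Matrix _ _ ℂ) α α' := by
      rw [Matrix.one_apply]; split_ifs <;> simp
    rw [h1] at h
    rw [← h, Matrix.mul_apply, Finset.mul_sum, Finset.mul_sum]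
    refine Finset.sum_congr rfl fun β _ => ?_
    simp only [Matrix.smul_apply, Matrix.transpose_apply, smul_eq_mul, star_mul',
      Matrix.conjTranspose_apply]
    linear_combination -(star t * star (T.down u y w α' β)) * hκ y w α β
  have hdiag : ∀ y w (α : Fin (mult S u y w)),
      (T.down u y w * (T.down u y w).conjTranspose) α α =
        ((∑ β, Complex.normSq (T.down u y w α β) : ℝ) : ℂ) := by
    intro y w α
    rw [Matrix.mul_apply, Complex.ofReal_sum]
    refine Finset.sum_congr rfl fun β _ => ?_
    rw [Matrix.conjTranspose_apply, Complex.normSq_eq_conj_mul_self, mul_comm]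
    rfl
  have hnn : ∀ y w (α : Fin (mult S u y w)),
      0 ≤ ∑ β, Complex.normSq (T.down u y w α β) := fun y w α =>
    Finset.sum_nonneg fun β _ => Complex.normSq_nonneg _
  -- For `y = u` and `w = o` the constant `√u √o / √u = √o` is real, so `star t * κ` has phase 1.
  obtain ⟨p, hp, hpκ⟩ : ∃ p : ℝ, 0 < p ∧ star t * κ = (p : ℂ) := by
    have h := key u o k k
    have hNu : T.normConst u o u = T.sqrtDim o := by
      have := T.sqrtDim_ne_zero u
      simp only [normConst]
      field_simp
    rw [hNu, hr, hdiag, Matrix.one_apply_eq] at h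
    set B := ∑ β, Complex.normSq (T.down u u o k β) with hB
    have h2 : star t * κ * (B : ℂ) = 1 :=
      mul_left_cancel₀ hr0 (by linear_combination h)
    have hB0 : (B : ℂ) ≠ 0 := right_ne_zero_of_mul_eq_one h2
    have hBpos : 0 < B := lt_of_le_of_ne (hnn u o k) (fun h => hB0 (by rw [← h]; simp))
    refine ⟨B⁻¹, inv_pos.mpr hBpos, ?_⟩
    rw [Complex.ofReal_inv]
    exact eq_inv_of_mul_eq_one_left h2
  have hp0 : (p : ℂ) ≠ 0 := Complex.ofReal_ne_zero.mpr hp.ne'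
  rw [hpκ] at key
  have hreal : ∀ y w, Fin (mult S u y w) → star (T.normConst u w y) = T.normConst u w y := by
    intro y w α
    have h := key y w α α
    rw [hdiag, Matrix.one_apply_eq, mul_one] at h
    set B := ∑ β, Complex.normSq (T.down u y w α β) with hB
    have hN0 : ‖T.normConst u w y‖ ≠ 0 := norm_ne_zero_iff.mpr (T.normConst_ne_zero u w y)
    -- Comparing absolute values, the nonnegative factor `p * B` must be one.
    have h2 := congrArg norm h
    rw [norm_mul, norm_mul, norm_star, Complex.norm_of_nonneg hp.le,
      Complex.norm_of_nonneg (hnn y w α)] at h2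
    have h3 : p * B = 1 := mul_right_cancel₀ hN0 (by linear_combination h2)
    have h4 : (p : ℂ) * (B : ℂ) = 1 := by rw [← Complex.ofReal_mul, h3, Complex.ofReal_one]
    rw [← h]
    linear_combination T.normConst u w y * h4
  refine ⟨(p : ℂ)⁻¹, inv_ne_zero hp0, fun y w => ⟨?_, hreal y w⟩⟩
  ext α α'
  have h := key y w α α'
  rw [hreal y w α] at h
  have hN0 := T.normConst_ne_zero u w y
  rw [Matrix.smul_apply, smul_eq_mul, eq_inv_mul_iff_mul_eq₀ hp0]
  exact mul_left_cancel₀ hN0 (by linear_combination h)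

theorem conjTranspose_mul_down {c : ℂ} {u y w : I}
    (h : T.down u y w * (T.down u y w).conjTranspose = c • 1) :
    (T.down u y w).conjTranspose * T.down u y w = c • 1 := by
  have h1 : (T.down u y w).conjTranspose = c • T.up u w y := by
    rw [← Matrix.one_mul (T.down u y w).conjTranspose, ← T.up_mul_down u w y, Matrix.mul_assoc, h,
      Matrix.mul_smul, Matrix.mul_one]
  rw [h1, Matrix.smul_mul, up_mul_down]

end TrivalentBasis

end BendUnitary

/-! ### Unitarity of the `6j`-matrices -/

section ScaledUnitary

open Matrix

variable {l m n : Type*} [Fintype l] [Fintype m] [Fintype n]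
  [DecidableEq l] [DecidableEq m] [DecidableEq n]

/-- A matrix whose conjugate transpose is `c` times a two-sided inverse. -/
def IsScaledUnitary (c : ℂ) (M : Matrix m n ℂ) : Prop :=
  Mᴴ * M = c • (1 : Matrix n n ℂ) ∧ M * Mᴴ = c • (1 : Matrix m m ℂ)

theorem IsScaledUnitary.transpose {c : ℂ} {M : Matrix m n ℂ} (h : IsScaledUnitary c M) :
    IsScaledUnitary c Mᵀ := by
  constructor
  · have := congrArg Matrix.transpose h.2
    rwa [transpose_mul, transpose_smul, transpose_one] at this
  · have := congrArg Matrix.transpose h.1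
    rwa [transpose_mul, transpose_smul, transpose_one] at this

theorem IsUnitaryMatrix.mul_isScaledUnitary {c : ℂ} {M : Matrix l m ℂ} {N : Matrix m n ℂ}
    (hM : IsUnitaryMatrix M) (hN : IsScaledUnitary c N) : IsScaledUnitary c (M * N) := by
  constructor
  · rw [conjTranspose_mul, Matrix.mul_assoc, ← Matrix.mul_assoc Mᴴ, hM.1, Matrix.one_mul, hN.1]
  · rw [conjTranspose_mul, Matrix.mul_assoc, ← Matrix.mul_assoc N, hN.2, Matrix.smul_mul,
      Matrix.one_mul, Matrix.mul_smul, hM.2]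

theorem IsScaledUnitary.isUnitaryMatrix_of_eq_mul {c : ℂ} (hc : c ≠ 0) {P : Matrix l n ℂ}
    {M : Matrix l m ℂ} {J : Matrix m n ℂ} (hP : IsScaledUnitary c P) (hM : IsScaledUnitary c M)
    (h : P = M * J) : IsUnitaryMatrix J := by
  have h1 : Mᴴ * P = c • J := by rw [h, ← Matrix.mul_assoc, hM.1, Matrix.smul_mul, Matrix.one_mul]
  constructor
  · have h2 : c • (Jᴴ * J) = c • (1 : Matrix n n ℂ) := by
      rw [← hP.1, ← Matrix.mul_smul, ← h1, ← Matrix.mul_assoc, ← conjTranspose_mul, ← h]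
    exact smul_right_injective _ hc h2
  · have h2 : c • (J * Jᴴ) = c • (1 : Matrix m m ℂ) := by
      have h3 : Jᴴ * Mᴴ = Pᴴ := by rw [← conjTranspose_mul, ← h]
      have h4 : (c • c) • (J * Jᴴ) = (c • c) • (1 : Matrix m m ℂ) := by
        calc (c • c) • (J * Jᴴ) = (c • J) * Jᴴ * (c • (1 : Matrix m m ℂ)) := by
              rw [Matrix.mul_smul, Matrix.mul_one, Matrix.smul_mul, smul_smul]; rfl
          _ = Mᴴ * (P * Pᴴ) * M := by
              rw [← h1, ← hM.1, ← h3]; simp only [Matrix.mul_assoc]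
          _ = _ := by
              rw [hP.2, Matrix.mul_smul, Matrix.mul_one, Matrix.smul_mul, hM.1, smul_smul]; rfl
      rw [smul_assoc, smul_assoc] at h4
      exact smul_right_injective _ hc h4
    exact smul_right_injective _ hc h2

theorem IsUnitaryMatrix.map_star_submatrix {M : Matrix m n ℂ} (hM : IsUnitaryMatrix M)
    {m' n' : Type*} [Fintype m'] [Fintype n'] [DecidableEq m'] [DecidableEq n']
    (e : m' ≃ m) (f : n' ≃ n) {N : Matrix m' n' ℂ} (h : ∀ i j, N i j = star (M (e i) (f j))) :
    IsUnitaryMatrix N := by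
  have hN : N = Mᴴᵀ.submatrix e f := by
    ext i j; rw [h]; rfl
  have hN' : Nᴴ = Mᵀ.submatrix f e := by
    ext i j; rw [conjTranspose_apply, h, star_star]; rfl
  constructor
  · rw [hN', hN, submatrix_mul_equiv, ← transpose_mul, hM.1, transpose_one,
      submatrix_one_equiv]
  · rw [hN', hN, submatrix_mul_equiv, ← transpose_mul, hM.2, transpose_one,
      submatrix_one_equiv]

theorem IsScaledUnitary.blockDiagonal' {ι : Type*} [Fintype ι] [DecidableEq ι] {m n : ι → Type*}
    [∀ i, Fintype (m i)] [∀ i, Fintype (n i)] [∀ i, DecidableEq (m i)] [∀ i, DecidableEq (n i)]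
    {c : ℂ} {M : ∀ i, Matrix (m i) (n i) ℂ} (h : ∀ i, IsScaledUnitary c (M i)) :
    IsScaledUnitary c (Matrix.blockDiagonal' M) := by
  constructor
  · rw [blockDiagonal'_conjTranspose, ← blockDiagonal'_mul, ← blockDiagonal'_one,
      ← blockDiagonal'_smul]
    congr 1
    exact funext fun i => (h i).1
  · rw [blockDiagonal'_conjTranspose, ← blockDiagonal'_mul, ← blockDiagonal'_one,
      ← blockDiagonal'_smul]
    congr 1
    exact funext fun i => (h i).2

open scoped Kronecker

theorem IsScaledUnitary.kronecker_one {c : ℂ} {M : Matrix m n ℂ} (h : IsScaledUnitary c M) :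
    IsScaledUnitary c (M ⊗ₖ (1 : Matrix l l ℂ)) := by
  constructor
  · rw [conjTranspose_kronecker, ← mul_kronecker_mul, h.1, conjTranspose_one, Matrix.one_mul,
      smul_kronecker, one_kronecker_one]
  · rw [conjTranspose_kronecker, ← mul_kronecker_mul, h.2, conjTranspose_one, Matrix.one_mul,
      smul_kronecker, one_kronecker_one]

theorem IsScaledUnitary.one_kronecker {c : ℂ} {M : Matrix m n ℂ} (h : IsScaledUnitary c M) :
    IsScaledUnitary c ((1 : Matrix l l ℂ) ⊗ₖ M) := by
  constructor
  · rw [conjTranspose_kronecker, ← mul_kronecker_mul, h.1, conjTranspose_one, Matrix.one_mul,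
      kronecker_smul, one_kronecker_one]
  · rw [conjTranspose_kronecker, ← mul_kronecker_mul, h.2, conjTranspose_one, Matrix.one_mul,
      kronecker_smul, one_kronecker_one]

end ScaledUnitary

section SixJ

open Matrix
open scoped Kronecker

variable {C : Type u} [Category.{v} C] [Preadditive C] [Linear ℂ C] [MonoidalCategory C]
  {I : Type*} {S : SimpleReps C I}
  [MonoidalPreadditive C] [MonoidalLinear ℂ C] [PivotalCategory C] [IsFusion C]

namespace TrivalentBasis

variable (T : TrivalentBasis S) [Fintype I] [DecidableEq I]
  [∀ u, ExactPairing (S.obj u) (S.obj u)]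

/-- The effect of bending the strand `u` down on the morphisms `exchangePlus`, with respect to the
left trees with leaves `u`, `w`, `x`. -/
def exchangeBend (u v w x : I) :
    Matrix ((y : I) × (Fin (mult S u w y) × Fin (mult S y x v)))
      ((y : I) × (Fin (mult S u y w) × Fin (mult S y x v))) ℂ :=
  blockDiagonal' fun y => (T.down u y w)ᵀ ⊗ₖ (1 : Matrix (Fin (mult S y x v)) _ ℂ)

/-- The effect of bending the strand `u` down on the basis `channel`, with respect to the right
trees with leaves `u`, `w`, `x`. -/
def channelBend (u v w x : I) :
    Matrix ((z : I) × (Fin (mult S w x z) × Fin (mult S u z v)))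
      ((z : I) × (Fin (mult S w x z) × Fin (mult S u v z))) ℂ :=
  blockDiagonal' fun z => (1 : Matrix (Fin (mult S w x z)) _ ℂ) ⊗ₖ (T.down u v z)ᵀ

theorem bendDown_exchangePlus (u v w x : I)
    (q : (y : I) × (Fin (mult S u y w) × Fin (mult S y x v))) :
    bendDown _ (S.obj u) (S.obj u) _ (T.exchangePlus u v w x q) =
      ∑ p, T.exchangeBend u v w x p q • ((α_ _ _ _).inv ≫ T.leftTree u w x v p) := by
  obtain ⟨y, α, β⟩ := q
  rw [exchangePlus, bendDown_exchange, bendDown_bar, sum_whiskerRight, Preadditive.sum_comp,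
    Preadditive.comp_sum, Fintype.sum_sigma, Finset.sum_eq_single y]
  · rw [Fintype.sum_prod_type]
    refine Finset.sum_congr rfl fun α' _ => ?_
    rw [Finset.sum_eq_single β]
    · simp [exchangeBend, blockDiagonal'_apply_eq, kroneckerMap_apply, leftTree]
    · intro β' _ hβ
      simp [exchangeBend, blockDiagonal'_apply_eq, kroneckerMap_apply, hβ]
    · simp
  · intro y' _ hy
    refine Finset.sum_eq_zero fun r _ => ?_
    rw [exchangeBend, blockDiagonal'_apply_ne _ _ _ hy, zero_smul]
  · simp

theorem bendDown_channel (u v w x : I)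
    (q : (z : I) × (Fin (mult S w x z) × Fin (mult S u v z))) :
    bendDown _ (S.obj u) (S.obj u) _ (T.channel u v w x q) =
      ∑ p, T.channelBend u v w x p q • T.rightTree u w x v p := by
  obtain ⟨z, γ, δ⟩ := q
  rw [channel, bendDown_comp, bendDown_bar,
    Preadditive.comp_sum, Fintype.sum_sigma, Finset.sum_eq_single z]
  · rw [Fintype.sum_prod_type_right]
    refine Finset.sum_congr rfl fun δ' _ => ?_
    rw [Finset.sum_eq_single γ]
    · simp [channelBend, blockDiagonal'_apply_eq, kroneckerMap_apply, rightTree]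
    · intro γ' _ hγ
      simp [channelBend, blockDiagonal'_apply_eq, kroneckerMap_apply, hγ]
    · simp
  · intro z' _ hz
    refine Finset.sum_eq_zero fun r _ => ?_
    rw [channelBend, blockDiagonal'_apply_ne _ _ _ hz, zero_smul]
  · simp

theorem exchangePlus_eq_sum (u v w x : I)
    (q : (y : I) × (Fin (mult S u y w) × Fin (mult S y x v))) :
    T.exchangePlus u v w x q = ∑ r, T.sixJPlus u v w x r q • T.channel u v w x r := by
  have h := (T.channelBasis u v w x).sum_repr (T.exchangePlus u v w x q)
  simp only [channelBasis, Module.Basis.coe_mk] at h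
  exact h.symm

/-- Bending the strand `u` down turns the defining equation of the `(+)6j`-symbols into that of
the associativity matrix `F` with leaves `u`, `w`, `x` and root `v`. -/
theorem exchangeBend_eq (u v w x : I) :
    T.exchangeBend u v w x =
      T.F u w x v * T.channelBend u v w x * T.sixJPlus u v w x := by
  ext p q
  have h := congrArg (fun f => (α_ _ _ _).hom ≫ bendDown _ (S.obj u) (S.obj u) _ f)
    (T.exchangePlus_eq_sum u v w x q)
  simp only [bendDown_exchangePlus, map_sum, map_smul, bendDown_channel, rightTree_eq_sum,
    Preadditive.comp_sum, Linear.comp_smul, Iso.hom_inv_id_assoc] at h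
  have h2 := congrArg (fun f => (T.leftTreeBasis u w x v).repr f p) h
  have hrepr : ∀ p', (T.leftTreeBasis u w x v).repr (T.leftTree u w x v p') p =
      if p' = p then 1 else 0 := by
    intro p'
    have : T.leftTree u w x v p' = T.leftTreeBasis u w x v p' := by simp [leftTreeBasis]
    rw [this, Module.Basis.repr_self, Finsupp.single_apply]
  simp only [map_sum, map_smul, Finsupp.coe_finsetSum,
    Finset.sum_apply, Finsupp.coe_smul, Pi.smul_apply, smul_eq_mul, hrepr,
    mul_ite, mul_one, mul_zero, Finset.sum_ite_eq', Finset.mem_univ, if_true] at h2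
  rw [h2, Matrix.mul_apply]
  refine Finset.sum_congr rfl fun r _ => ?_
  rw [Matrix.mul_apply, mul_comm]
  congr 1
  exact Finset.sum_congr rfl fun s _ => mul_comm _ _

variable [IsSpherical C]

/-- By `exchangeBend_eq`, the `(+)6j`-matrix is a quotient of two matrices that are unitary up to the
same scalar: the bending matrices involved all bend the strand `u`. -/
theorem isUnitaryMatrix_sixJPlus (hF : ∀ u v w x : I, IsUnitaryMatrix (T.F u v w x))
    (u v w x : I) : IsUnitaryMatrix (T.sixJPlus u v w x) := by
  obtain ⟨c, hc, h⟩ := T.exists_down_mul_conjTranspose hF u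
  have hd : ∀ y w, IsScaledUnitary c (T.down u y w)ᵀ := fun y w =>
    IsScaledUnitary.transpose ⟨T.conjTranspose_mul_down (h y w).1, (h y w).1⟩
  have hE : IsScaledUnitary c (T.exchangeBend u v w x) :=
    IsScaledUnitary.blockDiagonal' fun y => (hd y w).kronecker_one
  have hG : IsScaledUnitary c (T.channelBend u v w x) :=
    IsScaledUnitary.blockDiagonal' fun z => (hd v z).one_kronecker
  exact hE.isUnitaryMatrix_of_eq_mul hc ((hF u w x v).mul_isScaledUnitary hG)
    (T.exchangeBend_eq u v w x)

theorem sixJMinus_eq_star_sixJPlus (hF : ∀ u v w x : I, IsUnitaryMatrix (T.F u v w x))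
    (u v w x z y : I) (γ : Fin (mult S w x z)) (δ : Fin (mult S u v z))
    (α : Fin (mult S u y w)) (β : Fin (mult S y x v)) :
    T.sixJMinus w x u v ⟨z, δ, γ⟩ ⟨y, β, α⟩ =
      star (T.sixJPlus u v w x ⟨z, γ, δ⟩ ⟨y, α, β⟩) := by
  obtain ⟨_, -, h⟩ := T.exists_down_mul_conjTranspose hF u
  have h1 := (h y w).2 α
  have h2 := (h v z).2 δ
  -- The ratio of constants in the two formulas is one of two real constants with first label `u`.
  have hq : T.normConst y x v / T.normConst w x z = T.normConst u z v / T.normConst u w y := by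
    have := T.sqrtDim_ne_zero
    simp only [normConst]
    field_simp [this u, this v, this w, this x, this y, this z]
  rw [sixJMinus_eq, sixJPlus_eq, T.G_eq_star_F (hF _ _ _ _), star_mul', hq, star_div₀, h1, h2]

theorem isUnitaryMatrix_sixJMinus (hF : ∀ u v w x : I, IsUnitaryMatrix (T.F u v w x))
    (u v w x : I) : IsUnitaryMatrix (T.sixJMinus u v w x) :=
  (T.isUnitaryMatrix_sixJPlus hF w x u v).map_star_submatrix
    (Equiv.sigmaCongrRight fun _ => Equiv.prodComm _ _)
    (Equiv.sigmaCongrRight fun _ => Equiv.prodComm _ _)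
    fun ⟨z, δ, γ⟩ ⟨y, β, α⟩ => T.sixJMinus_eq_star_sixJPlus hF w x u v z y γ δ α β

end TrivalentBasis

end SixJ

end SphericalFusion

end

theorem mainTheorem1 {C : Type*} [Category C] [Preadditive C] [Linear ℂ C]
    [MonoidalCategory C] [MonoidalPreadditive C] [MonoidalLinear ℂ C]
    [SphericalFusion.PivotalCategory C] [SphericalFusion.IsSpherical C]
    [SphericalFusion.IsFusion C]
    {I : Type*} [Fintype I] [DecidableEq I] (S : SphericalFusion.SimpleReps C I)
    (hdual : ∀ i, Nonempty (S.obj i ≅ SphericalFusion.PivotalCategory.dual (S.obj i)))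
    (T : SphericalFusion.TrivalentBasis S)
    (hF : ∀ u v w x : I, SphericalFusion.IsUnitaryMatrix (T.F u v w x)) :
    ((∀ (u v w x z y : I) (γ : Fin (SphericalFusion.mult S u v z))
        (δ : Fin (SphericalFusion.mult S z w x)) (α : Fin (SphericalFusion.mult S v w y))
        (β : Fin (SphericalFusion.mult S u y x)),
        T.G u v w x ⟨z, γ, δ⟩ ⟨y, α, β⟩ = star (T.F u v w x ⟨z, γ, δ⟩ ⟨y, α, β⟩)) ∧
      (∀ (u v w x z y : I) (γ : Fin (SphericalFusion.mult S w x z))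
        (δ : Fin (SphericalFusion.mult S u v z)) (α : Fin (SphericalFusion.mult S u y w))
        (β : Fin (SphericalFusion.mult S y x v)),
        T.sixJMinus w x u v ⟨z, δ, γ⟩ ⟨y, β, α⟩ =
          star (T.sixJPlus u v w x ⟨z, γ, δ⟩ ⟨y, α, β⟩))) ∧
    (∀ u v w x : I, SphericalFusion.IsUnitaryMatrix (T.sixJPlus u v w x) ∧
      SphericalFusion.IsUnitaryMatrix (T.sixJMinus u v w x)) := by
  have _ : ∀ u, ExactPairing (S.obj u) (S.obj u) := fun u =>
    (SphericalFusion.nonempty_exactPairing_self _ (hdual u)).some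
  exact ⟨⟨fun u v w x z y γ δ α β => T.G_eq_star_F (hF u v w x) _ _,
    T.sixJMinus_eq_star_sixJPlus hF⟩,
    fun u v w x => ⟨T.isUnitaryMatrix_sixJPlus hF u v w x, T.isUnitaryMatrix_sixJMinus hF u v w x⟩⟩
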